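/- Let $n\ge 1$ and let $\langle\cdot,\cdot\rangle$ be the standard scalar product of $\mathbb R^n$. A convex body is a compact convex subset of $\mathbb R^n$ with nonempty interior. A zonotope is a finite Minkowski sum of segments, and a zonoid is a compact set that is a limit of zonotopes in the Hausdorff distance. For a set $K\subset\mathbb R^n$ put $K^*=\{y\in\mathbb R^n:\langle x,y\rangle\le 1\text{ for all }x\in K\}$ and $K^z=(K-z)^*+z$, and for a convex body $K$ let $\mathcal P(K)=\mathrm{vol}(K)\,\min_{z\in\mathrm{int}K}\mathrm{vol}(K^z)$ be its volume product. For a unit vector $u$ let $P_{u^\perp}$ be the orthogonal projection onto the hyperplane $u^\perp$, and let $\mathrm{vol}_{n-1}$ be Lebesgue measure on $u^\perp$ (for $n=1$, $\mathrm{vol}_0(\{0\})=1$). Let $Z\subset\mathbb R^n$ be a convex body that is a zonoid and satisfies $Z=-Z$. Then: (1) there is a unit vector $u\in S^{n-1}$ such that $$\mathrm{vol}(Z)\,\mathrm{vol}(Z^*)\ \ge\ \frac4n\,\mathrm{vol}_{n-1}(P_{u^\perp}Z)\,\mathrm{vol}_{n-1}(Z^*\cap u^\perp);$$ (2) $\mathcal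 P(Z)\ge \dfrac{4^n}{n!}$, with equality if and only if $Z=T([-1,1]^n)$ for some linear isomorphism $T$ of $\mathbb R^n$; (3) $\mathcal P(Z^*)\ge \dfrac{4^n}{n!}$, with equality if and only if $Z=T([-1,1]^n)$ for some linear isomorphism $T$ of $\mathbb R^n$. -/

import Mathlib

open MeasureTheory Filter Topology
open scoped ENNReal Pointwise Nat RealInnerProductSpace

noncomputable section

namespace ConvexVol

variable {E : Type*} [NormedAddCommGroup E] [InnerProductSpace ℝ E]

/-- A convex body: a compact convex set with nonempty interior. -/
structure IsConvexBody (K : Set E) : Prop where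
  convex : Convex ℝ K
  isCompact : IsCompact K
  nonempty_interior : (interior K).Nonempty

/-- A zonotope: a finite Minkowski sum of segments. -/
def IsZonotope (P : Set E) : Prop :=
  ∃ (m : ℕ) (a b : Fin m → E), P = ∑ i, segment ℝ (a i) (b i)

/-- A zonoid: a (compact) limit of zonotopes in the Hausdorff distance. -/
def IsZonoid (Z : Set E) : Prop :=
  IsCompact Z ∧ ∃ P : ℕ → Set E, (∀ k, IsZonotope (P k)) ∧
    Tendsto (fun k => Metric.hausdorffEDist (P k) Z) atTop (𝓝 0)

/-- The polar `K^* = {y : ⟪x, y⟫ ≤ 1 for all x ∈ K}` with respect to the origin. -/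
def polarBody (K : Set E) : Set E :=
  {y | ∀ x ∈ K, ⟪x, y⟫ ≤ 1}

/-- The polar `K^z = (K - z)^* + z` with respect to the point `z`. -/
def polarBodyAt (K : Set E) (z : E) : Set E :=
  (fun y => y + z) '' polarBody ((fun x => x - z) '' K)

/-- The volume product `P(K) = vol(K) * min {vol(K^z) : z ∈ int K}`. For a convex body the minimum
is attained, at the Santalo point of `K`. -/
def volumeProduct [FiniteDimensional ℝ E] [MeasurableSpace E] [BorelSpace E] (K : Set E) : ℝ≥0∞ :=
  volume K * ⨅ z ∈ interior K, volume (polarBodyAt K z)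

/-- The orthogonal projection `P_F K`, as a subset of the subspace `F`. -/
def projectionOnto [FiniteDimensional ℝ E] (F : Submodule ℝ E) (K : Set E) : Set F :=
  F.orthogonalProjectionOnto '' K

/-- The section `K ∩ F`, as a subset of the subspace `F`. -/
def sectionBy (F : Submodule ℝ E) (K : Set E) : Set F :=
  {x | (x : E) ∈ K}

/-- Lebesgue measure of the subspace `F` with its inherited inner product, normalised so that a
cube spanned by an orthonormal basis of `F` has measure one. -/
def subspaceVolume [FiniteDimensional ℝ E] [MeasurableSpace E] [BorelSpace E]
    (F : Submodule ℝ E) : Measure F :=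
  (stdOrthonormalBasis ℝ F).toBasis.addHaar

/-- The cube `[-1, 1]^n`. -/
def unitCube (n : ℕ) : Set (EuclideanSpace ℝ (Fin n)) :=
  {x | ∀ i, |x i| ≤ 1}

/-- A linear image of the cube `[-1, 1]^n` under a linear isomorphism of `ℝ^n`, that is, a
parallelepiped centred at the origin. -/
def IsLinearCube {n : ℕ} (Z : Set (EuclideanSpace ℝ (Fin n))) : Prop :=
  ∃ T : EuclideanSpace ℝ (Fin n) ≃ₗ[ℝ] EuclideanSpace ℝ (Fin n), Z = T '' unitCube n

end ConvexVol

end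

/-! Write $N=h_Z$, $V=\mathrm{vol}(Z)$, $I=\int e^{-N}=n!\,\mathrm{vol}(Z^*)$ and $M(u)=\int|\langle
x,u\rangle|e^{-N}$. A zonoid has $N\approx\sum c_i|\langle x,u_i\rangle|$ with unit vectors $u_i$.
Integrating this against $e^{-N}$ gives $nI\approx\sum c_iM(u_i)$, by homogeneity. Adding small
segments to $Z$ gives $nV\approx2\sum c_i\,\mathrm{vol}(P_{u_i^\perp}Z)$, a first-order Minkowski
inequality. Comparing the two weighted sums, some direction satisfies
$2\,\mathrm{vol}(P_{u^\perp}Z)\,I\le M(u)V$ up to the error; compactness of the sphere removes the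
error (`exists_projVol_mul_le`).

Let $F(t)$ be the integral of $e^{-N}$ over the hyperplane at height $t$. Prékopa-Leindler gives
$F(0)F(s+t)\le F(s)F(t)$ for $s,t>0$; integrated over the quadrant this is $2F(0)M(u)\le I^2$.
Together with the previous inequality it yields $4\,\mathrm{vol}(P_{u^\perp}Z)F(0)\le VI$
(`exists_four_mul_le`), which is (1) because $F(0)=(n-1)!\,\mathrm{vol}(Z^*\cap u^\perp)$. The
restriction of $N$ to $u^\perp$ is the support function of the zonoid $P_{u^\perp}Z$, so induction
on the dimension gives $4^n\le VI$ (`four_pow_le_of_isZonoidal`).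

Under equality $F/F(0)$ is multiplicative, hence decays at an exact exponential rate. That rate is
fixed by the width of $Z^*$ in direction $u$, which forces $Z^*$ to be a double cone
(`exists_split_of_eq`). Inductively $N=\sum|\langle x,b_i\rangle|$ with $n$ terms, so $Z$ is a
parallelepiped. By symmetry the infimum in the volume product is attained at the origin, and the
bipolar theorem reduces (3) to (2). -/

namespace ConvexVol

/-! ### Brunn-Minkowski on the line and Prékopa-Leindler -/

/-- One-dimensional Brunn-Minkowski inequality for compact sets. -/
lemma volume_add_volume_le_of_isCompact {A B : Set ℝ} (hA : IsCompact A) (hB : IsCompact B)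
    (hA' : A.Nonempty) (hB' : B.Nonempty) : volume A + volume B ≤ volume (A + B) := by
  -- With a = max A and b = min B, the translates A + b and a + B lie in A + B and meet only at a +
  -- b.
  obtain ⟨a, haA, ha⟩ := hA.exists_isGreatest hA'
  obtain ⟨b, hbB, hb⟩ := hB.exists_isLeast hB'
  have h1 : volume ((fun x => x + b) '' A) = volume A := by
    rw [Set.image_add_right]; simp
  have h2 : volume ((fun x => a + x) '' B) = volume B := by
    rw [Set.image_add_left]; simp
  have hd : AEDisjoint volume ((fun x => x + b) '' A) ((fun x => a + x) '' B) := by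
    refine measure_mono_null (t := {a + b}) ?_ (by simp)
    rintro _ ⟨⟨x, hx, rfl⟩, ⟨y, hy, hxy⟩⟩
    have := ha hx
    have := hb hy
    simp only [Set.mem_singleton_iff] at *
    linarith
  have hm : MeasurableSet ((fun x => a + x) '' B) :=
    (hB.image (by fun_prop)).measurableSet
  rw [← h1, ← h2, ← measure_union₀ hm.nullMeasurableSet hd]
  refine measure_mono ?_
  rintro _ (⟨x, hx, rfl⟩ | ⟨x, hx, rfl⟩)
  · exact Set.add_mem_add hx hbB
  · exact Set.add_mem_add haA hx

/-- One-dimensional Brunn-Minkowski inequality. -/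
lemma volume_add_volume_le {A B : Set ℝ} (hA : MeasurableSet A) (hB : MeasurableSet B)
    (hA' : A.Nonempty) (hB' : B.Nonempty) : volume A + volume B ≤ volume (A + B) := by
  obtain ⟨x, hx⟩ := hA'
  obtain ⟨y, hy⟩ := hB'
  rw [hA.measure_eq_iSup_isCompact, hB.measure_eq_iSup_isCompact]
  simp_rw [iSup_and']
  refine ENNReal.biSup_add_biSup_le' (p := fun K => K ⊆ A ∧ IsCompact K)
    (q := fun K => K ⊆ B ∧ IsCompact K) ⟨∅, by simp⟩ ⟨∅, by simp⟩ ?_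
  rintro K ⟨hKA, hK⟩ L ⟨hLB, hL⟩
  -- The inner compact sets may be empty; adjoining a point makes the compact case applicable.
  calc volume K + volume L ≤ volume (insert x K) + volume (insert y L) := by
        gcongr <;> exact Set.subset_insert _ _
    _ ≤ volume (insert x K + insert y L) :=
        volume_add_volume_le_of_isCompact (hK.insert x) (hL.insert y) (by simp) (by simp)
    _ ≤ _ := measure_mono
        (Set.add_subset_add (Set.insert_subset hx hKA) (Set.insert_subset hy hLB))

lemma volume_weighted_add_le {A B C : Set ℝ} {a b : ℝ} (ha : 0 < a) (hb : 0 < b)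
    (hA : MeasurableSet A) (hB : MeasurableSet B)
    (hA' : A.Nonempty) (hB' : B.Nonempty) (h : ∀ x ∈ A, ∀ y ∈ B, a * x + b * y ∈ C) :
    ENNReal.ofReal a * volume A + ENNReal.ofReal b * volume B ≤ volume C := by
  have h1 : ∀ {c : ℝ} (S : Set ℝ), 0 < c → ENNReal.ofReal c * volume S = volume (c • S) := by
    intro c S hc
    rw [Measure.addHaar_smul]
    simp [abs_of_pos hc]
  rw [h1 A ha, h1 B hb]
  refine (volume_add_volume_le (hA.const_smul_of_ne_zero ha.ne')
    (hB.const_smul_of_ne_zero hb.ne') hA'.smul_set hB'.smul_set).trans (measure_mono ?_)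
  rintro _ ⟨_, ⟨x, hx, rfl⟩, _, ⟨y, hy, rfl⟩, rfl⟩
  exact h x hx y hy

/-- Layer-cake formula cut off at level 1. For a function with supremum 1 every remaining superlevel
set is nonempty, as Brunn-Minkowski requires. -/
lemma lintegral_eq_lintegral_Ioo_of_le_one {f : ℝ → ℝ≥0∞} (hf : Measurable f)
    (h1 : ∀ x, f x ≤ 1) :
    ∫⁻ x, f x = ∫⁻ t in Set.Ioo (0 : ℝ) 1, volume {x | ENNReal.ofReal t < f x} := by
  have hne : ∀ x, f x ≠ ∞ := fun x => ((h1 x).trans_lt ENNReal.one_lt_top).ne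
  have e1 : ∫⁻ x, f x = ∫⁻ x, ENNReal.ofReal (f x).toReal := by
    simp [ENNReal.ofReal_toReal, hne]
  rw [e1, lintegral_eq_lintegral_meas_lt _ (ae_of_all _ fun x => ENNReal.toReal_nonneg)
    hf.ennreal_toReal.aemeasurable, ← Set.Ioo_union_Ici_eq_Ioi zero_lt_one,
    lintegral_union measurableSet_Ici]
  · have h0 : ∫⁻ t in Set.Ici (1 : ℝ), volume {x | t < (f x).toReal} = 0 := by
      rw [setLIntegral_congr_fun (g := fun _ => 0) measurableSet_Ici]
      · simp
      · intro t ht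
        have : {x | t < (f x).toReal} = ∅ := by
          ext x
          have := ENNReal.toReal_mono ENNReal.one_ne_top (h1 x)
          simp at this ht ⊢
          linarith
        simp [this]
    rw [h0, add_zero]
    refine setLIntegral_congr_fun measurableSet_Ioo fun t ht => ?_
    congr 1
    ext x
    exact (ENNReal.ofReal_lt_iff_lt_toReal ht.1.le (hne x)).symm
  · rw [Set.disjoint_left]
    intro x hx hx'
    exact absurd hx.2 (not_lt.2 hx')

/-- Prékopa-Leindler on the line for functions with supremum one. -/
lemma lintegral_add_le_of_iSup_eq_one {f g h : ℝ → ℝ≥0∞} (hf : Measurable f) (hg : Measurable g)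
    (hh : Measurable h) {a b : ℝ} (ha : 0 < a) (hb : 0 < b) (hab : a + b = 1)
    (hf1 : ⨆ x, f x = 1) (hg1 : ⨆ x, g x = 1)
    (H : ∀ x y, f x ^ a * g y ^ b ≤ h (a * x + b * y)) :
    ENNReal.ofReal a * (∫⁻ x, f x) + ENNReal.ofReal b * (∫⁻ x, g x) ≤ ∫⁻ x, h x := by
  have hfle : ∀ x, f x ≤ 1 := fun x => hf1 ▸ le_iSup f x
  have hgle : ∀ x, g x ≤ 1 := fun x => hg1 ▸ le_iSup g x
  have hmin : ∫⁻ x, min (h x) 1 ≤ ∫⁻ x, h x := lintegral_mono fun x => min_le_left _ _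
  refine le_trans ?_ hmin
  rw [lintegral_eq_lintegral_Ioo_of_le_one hf hfle, lintegral_eq_lintegral_Ioo_of_le_one hg hgle,
    lintegral_eq_lintegral_Ioo_of_le_one (hh.min measurable_const) (fun x => min_le_right _ _),
    ← lintegral_const_mul' _ _ ENNReal.ofReal_ne_top,
    ← lintegral_const_mul' _ _ ENNReal.ofReal_ne_top, ← lintegral_add_left']
  · refine setLIntegral_mono' measurableSet_Ioo fun t ht => ?_
    have ht1 : ENNReal.ofReal t < 1 := by
      rw [← ENNReal.ofReal_one]; exact (ENNReal.ofReal_lt_ofReal_iff one_pos).2 ht.2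
    have ht0 : 0 < ENNReal.ofReal t := ENNReal.ofReal_pos.2 ht.1
    obtain ⟨x₀, hx₀⟩ := lt_iSup_iff.1 (ht1.trans_eq hf1.symm)
    obtain ⟨y₀, hy₀⟩ := lt_iSup_iff.1 (ht1.trans_eq hg1.symm)
    refine volume_weighted_add_le ha hb (measurableSet_lt measurable_const hf)
      (measurableSet_lt measurable_const hg) ⟨x₀, hx₀⟩ ⟨y₀, hy₀⟩ fun x hx y hy => ?_
    refine lt_min (lt_of_lt_of_le ?_ (H x y)) ht1
    have : ENNReal.ofReal t = ENNReal.ofReal t ^ a * ENNReal.ofReal t ^ b := by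
      rw [← ENNReal.rpow_add _ _ ht0.ne' ENNReal.ofReal_ne_top, hab, ENNReal.rpow_one]
    rw [this]
    exact ENNReal.mul_lt_mul (ENNReal.rpow_lt_rpow hx ha) (ENNReal.rpow_lt_rpow hy hb)
  · refine (Antitone.measurable fun s t hst => ?_).aemeasurable.const_mul _
    exact measure_mono fun x hx => lt_of_le_of_lt (ENNReal.ofReal_le_ofReal hst) hx

/-- Young's inequality with exponents 1/a and 1/b; it turns the additive form of Prékopa-Leindler
into the multiplicative one. -/
lemma ennreal_geom_le_arith {a b : ℝ} (ha : 0 < a) (hb : 0 < b) (hab : a + b = 1)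
    (x y : ℝ≥0∞) : x ^ a * y ^ b ≤ ENNReal.ofReal a * x + ENNReal.ofReal b * y := by
  have hpq : (1 / a).HolderConjugate (1 / b) := by
    rw [Real.holderConjugate_iff]
    constructor
    · rw [lt_div_iff₀ ha]; linarith
    · simpa using hab
  have := ENNReal.young_inequality (x ^ a) (y ^ b) hpq
  rw [← ENNReal.rpow_mul, ← ENNReal.rpow_mul, mul_one_div_cancel ha.ne',
    mul_one_div_cancel hb.ne', ENNReal.rpow_one, ENNReal.rpow_one] at this
  refine this.trans (le_of_eq ?_)
  rw [one_div, one_div, ENNReal.ofReal_inv_of_pos ha, ENNReal.ofReal_inv_of_pos hb,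
    ENNReal.div_eq_inv_mul, ENNReal.div_eq_inv_mul, inv_inv, inv_inv]

/-- Prékopa-Leindler on the line for bounded functions. -/
lemma prekopa_leindler_real_of_bounded {f g h : ℝ → ℝ≥0∞} (hf : Measurable f) (hg : Measurable g)
    (hh : Measurable h) {a b : ℝ} (ha : 0 < a) (hb : 0 < b) (hab : a + b = 1)
    (hfb : ⨆ x, f x ≠ ∞) (hgb : ⨆ x, g x ≠ ∞)
    (H : ∀ x y, f x ^ a * g y ^ b ≤ h (a * x + b * y)) :
    (∫⁻ x, f x) ^ a * (∫⁻ x, g x) ^ b ≤ ∫⁻ x, h x := by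
  by_cases hf0 : ⨆ x, f x = 0
  · have : ∀ x, f x = 0 := by simpa using hf0
    simp [this, ha]
  by_cases hg0 : ⨆ x, g x = 0
  · have : ∀ x, g x = 0 := by simpa using hg0
    simp [this, hb]
  set α := ⨆ x, f x
  set β := ⨆ x, g x
  set γ := α ^ a * β ^ b with hγ
  have hαi := ENNReal.inv_ne_top.2 hf0
  have hβi := ENNReal.inv_ne_top.2 hg0
  have hγ0 : γ ≠ 0 := mul_ne_zero (by simp [ENNReal.rpow_eq_zero_iff, hf0, hfb])
    (by simp [ENNReal.rpow_eq_zero_iff, hg0, hgb])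
  have hγt : γ ≠ ∞ := ENNReal.mul_ne_top (ENNReal.rpow_ne_top_of_nonneg ha.le hfb)
    (ENNReal.rpow_ne_top_of_nonneg hb.le hgb)
  have hγi : γ⁻¹ = (α⁻¹) ^ a * (β⁻¹) ^ b := by
    rw [hγ, ENNReal.mul_inv (Or.inr (ENNReal.rpow_ne_top_of_nonneg hb.le hgb))
      (Or.inl (ENNReal.rpow_ne_top_of_nonneg ha.le hfb)), ENNReal.inv_rpow, ENNReal.inv_rpow]
  -- Normalise both suprema to 1; dividing h by the weighted geometric mean γ preserves the
  -- hypothesis.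
  have key := lintegral_add_le_of_iSup_eq_one (f := fun x => α⁻¹ * f x) (g := fun x => β⁻¹ * g x)
    (h := fun x => γ⁻¹ * h x) (by fun_prop) (by fun_prop) (by fun_prop) ha hb hab
    (by rw [← ENNReal.mul_iSup, ENNReal.inv_mul_cancel hf0 hfb])
    (by rw [← ENNReal.mul_iSup, ENNReal.inv_mul_cancel hg0 hgb])
    (fun x y => by
      rw [ENNReal.mul_rpow_of_nonneg _ _ ha.le, ENNReal.mul_rpow_of_nonneg _ _ hb.le,
        mul_mul_mul_comm, ← hγi]
      gcongr
      exact H x y)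
  have key2 := (ennreal_geom_le_arith ha hb hab _ _).trans key
  rw [lintegral_const_mul _ hf, lintegral_const_mul _ hg, lintegral_const_mul _ hh,
    ENNReal.mul_rpow_of_nonneg _ _ ha.le, ENNReal.mul_rpow_of_nonneg _ _ hb.le,
    mul_mul_mul_comm, ← hγi] at key2
  exact (ENNReal.mul_le_mul_iff_right (ENNReal.inv_ne_zero.2 hγt)
    (ENNReal.inv_ne_top.2 hγ0)).1 key2

/-- Prékopa-Leindler on the line. -/
lemma prekopa_leindler_real {f g h : ℝ → ℝ≥0∞} (hf : Measurable f) (hg : Measurable g)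
    (hh : Measurable h) {a b : ℝ} (ha : 0 < a) (hb : 0 < b) (hab : a + b = 1)
    (H : ∀ x y, f x ^ a * g y ^ b ≤ h (a * x + b * y)) :
    (∫⁻ x, f x) ^ a * (∫⁻ x, g x) ^ b ≤ ∫⁻ x, h x := by
  by_cases hf0 : ∫⁻ x, f x = 0
  · simp [hf0, ha]
  by_cases hg0 : ∫⁻ x, g x = 0
  · simp [hg0, hb]
  have tr : ∀ {f : ℝ → ℝ≥0∞}, Measurable f →
      Tendsto (fun k : ℕ => ∫⁻ x, min (f x) k) atTop (𝓝 (∫⁻ x, f x)) := by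
    intro f hf
    refine lintegral_tendsto_of_tendsto_of_monotone
      (fun k => (hf.min measurable_const).aemeasurable)
      (ae_of_all _ fun x i j hij => ?_) (ae_of_all _ fun x => ?_)
    · exact min_le_min_left _ (by exact_mod_cast hij)
    · have := (tendsto_const_nhds (x := f x)).min ENNReal.tendsto_nat_nhds_top
      simpa using this
  -- Zero integrals were excluded because multiplication in `ℝ≥0∞` is discontinuous at (0, ∞).
  have hlim := ENNReal.Tendsto.mul
    (((ENNReal.continuous_rpow_const (y := a)).tendsto _).comp (tr hf))
    (Or.inl (by simp [ENNReal.rpow_eq_zero_iff, hf0, not_lt.2 ha.le]))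
    (((ENNReal.continuous_rpow_const (y := b)).tendsto _).comp (tr hg))
    (Or.inl (by simp [ENNReal.rpow_eq_zero_iff, hg0, not_lt.2 hb.le]))
  refine le_of_tendsto hlim (Eventually.of_forall fun k => ?_)
  refine prekopa_leindler_real_of_bounded (hf.min measurable_const) (hg.min measurable_const) hh
    ha hb hab ?_ ?_ fun x y => le_trans ?_ (H x y)
  · exact ((iSup_le fun x => min_le_right _ _).trans_lt (ENNReal.natCast_lt_top k)).ne
  · exact ((iSup_le fun x => min_le_right _ _).trans_lt (ENNReal.natCast_lt_top k)).ne
  · exact mul_le_mul' (ENNReal.rpow_le_rpow (min_le_left _ _) ha.le)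
      (ENNReal.rpow_le_rpow (min_le_left _ _) hb.le)

lemma lintegral_pi_fin_succ {n : ℕ} {f : (Fin (n + 1) → ℝ) → ℝ≥0∞} (hf : Measurable f) :
    ∫⁻ x, f x = ∫⁻ t : ℝ, ∫⁻ y : Fin n → ℝ, f (Fin.cons t y) := by
  have mp := (volume_preserving_piFinSuccAbove (fun _ : Fin (n + 1) => ℝ) 0).symm
  rw [← mp.lintegral_comp hf, Measure.volume_eq_prod, lintegral_prod]
  · refine lintegral_congr fun t => lintegral_congr fun y => ?_
    simp [MeasurableEquiv.piFinSuccAbove]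
    rfl
  · exact (hf.comp (MeasurableEquiv.measurable _)).aemeasurable

lemma measurable_fin_cons {n : ℕ} :
    Measurable fun p : ℝ × (Fin n → ℝ) => (Fin.cons p.1 p.2 : Fin (n + 1) → ℝ) := by
  refine measurable_pi_lambda _ fun i => ?_
  refine Fin.cases ?_ (fun j => ?_) i
  · simpa using measurable_fst
  · simpa using (measurable_pi_iff.1 measurable_snd) j

/-- Prékopa-Leindler on `ℝ^n`. -/
lemma prekopa_leindler_pi (n : ℕ) {f g h : (Fin n → ℝ) → ℝ≥0∞} (hf : Measurable f)
    (hg : Measurable g) (hh : Measurable h) {a b : ℝ} (ha : 0 < a) (hb : 0 < b) (hab : a + b = 1)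
    (H : ∀ x y, f x ^ a * g y ^ b ≤ h (a • x + b • y)) :
    (∫⁻ x, f x) ^ a * (∫⁻ x, g x) ^ b ≤ ∫⁻ x, h x := by
  induction n with
  | zero =>
    simp only [volume_pi, Measure.pi_of_empty (x := (0 : Fin 0 → ℝ))]
    rw [lintegral_dirac, lintegral_dirac, lintegral_dirac]
    simpa using H 0 0
  | succ n ih =>
    rw [lintegral_pi_fin_succ hf, lintegral_pi_fin_succ hg, lintegral_pi_fin_succ hh]
    refine prekopa_leindler_real ?_ ?_ ?_ ha hb hab fun s t => ?_
    · exact (hf.comp measurable_fin_cons).lintegral_prod_right'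
    · exact (hg.comp measurable_fin_cons).lintegral_prod_right'
    · exact (hh.comp measurable_fin_cons).lintegral_prod_right'
    · have hm : ∀ r : ℝ, Measurable fun y : Fin n → ℝ => (Fin.cons r y : Fin (n + 1) → ℝ) :=
        fun r => measurable_fin_cons.comp measurable_prodMk_left
      refine ih (hf.comp (hm s)) (hg.comp (hm t)) (hh.comp (hm _)) fun x y => ?_
      have e : a • (Fin.cons s x : Fin (n + 1) → ℝ) + b • (Fin.cons t y : Fin (n + 1) → ℝ)
          = Fin.cons (a * s + b * t) (a • x + b • y) := by
        ext i
        refine Fin.cases ?_ (fun j => ?_) i <;> simp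
      simpa [e] using H (Fin.cons s x) (Fin.cons t y)

/-! ### Lebesgue measure, slicing by hyperplanes, homogeneous functions -/

section StdVol

variable (E : Type*) [NormedAddCommGroup E] [InnerProductSpace ℝ E] [FiniteDimensional ℝ E]
  [MeasurableSpace E] [BorelSpace E]

/-- Lebesgue measure of a finite-dimensional inner product space. -/
noncomputable def stdVol : Measure E := (stdOrthonormalBasis ℝ E).toBasis.addHaar

instance : (stdVol E).IsAddHaarMeasure := by unfold stdVol; infer_instance

instance : SigmaFinite (stdVol E) := by unfold stdVol; infer_instance

variable {E}

lemma measurePreserving_stdVol_coords :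
    MeasurePreserving (fun x : E => (WithLp.ofLp ((stdOrthonormalBasis ℝ E).repr x)))
      (stdVol E) volume :=
  (PiLp.volume_preserving_ofLp _).comp (stdOrthonormalBasis ℝ E).measurePreserving_repr

/-- Prékopa-Leindler on a finite-dimensional inner product space. -/
lemma prekopa_leindler {f g h : E → ℝ≥0∞} (hf : Measurable f)
    (hg : Measurable g) (hh : Measurable h) {a b : ℝ} (ha : 0 < a) (hb : 0 < b) (hab : a + b = 1)
    (H : ∀ x y, f x ^ a * g y ^ b ≤ h (a • x + b • y)) :
    (∫⁻ x, f x ∂stdVol E) ^ a * (∫⁻ x, g x ∂stdVol E) ^ b ≤ ∫⁻ x, h x ∂stdVol E := by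
  let e : E ≃L[ℝ] (Fin (Module.finrank ℝ E) → ℝ) :=
    (stdOrthonormalBasis ℝ E).repr.toContinuousLinearEquiv.trans (PiLp.continuousLinearEquiv 2 ℝ _)
  have he : MeasurePreserving e (stdVol E) volume := measurePreserving_stdVol_coords
  have hm : Measurable e.symm := e.symm.continuous.measurable
  have key := prekopa_leindler_pi _ (hf.comp hm) (hg.comp hm) (hh.comp hm) ha hb hab
    (fun x y => by simpa using H (e.symm x) (e.symm y))
  rw [← he.lintegral_comp (hf.comp hm), ← he.lintegral_comp (hg.comp hm),
    ← he.lintegral_comp (hh.comp hm)] at key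
  simpa using key

lemma stdVol_eq_volume (n : ℕ) : stdVol (EuclideanSpace ℝ (Fin n)) = volume := rfl

/-- The isometric splitting of E into the line of u and its orthogonal complement is what makes
Fubini in direction u available. -/
lemma measurePreserving_hyperplane {u : E} (hu : ‖u‖ = 1) :
    MeasurePreserving (fun p : ℝ × (ℝ ∙ u)ᗮ => (p.2 : E) + p.1 • u)
      ((volume : Measure ℝ).prod (stdVol (ℝ ∙ u)ᗮ)) (stdVol E) := by
  let U := ℝ ∙ u
  have h1 : MeasurePreserving (LinearIsometryEquiv.toSpanUnitSingleton (𝕜 := ℝ) u hu) volume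
      (stdVol U) := LinearIsometryEquiv.measurePreserving _
  have h2 := h1.prod (MeasurePreserving.id (stdVol Uᗮ))
  have h3 : MeasurePreserving (WithLp.toLp 2) ((stdVol U).prod (stdVol Uᗮ))
      (stdVol (WithLp 2 (U × Uᗮ))) := WithLp.volume_preserving_toLp U Uᗮ
  have h4 : MeasurePreserving U.orthogonalDecomposition.symm (stdVol (WithLp 2 (U × Uᗮ)))
      (stdVol E) := LinearIsometryEquiv.measurePreserving _
  convert h4.comp (h3.comp h2) using 1
  ext p
  simp [U, Submodule.orthogonalDecomposition_symm_apply, add_comm]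

lemma lintegral_hyperplane {u : E} (hu : ‖u‖ = 1) {f : E → ℝ≥0∞} (hf : Measurable f) :
    ∫⁻ x, f x ∂stdVol E = ∫⁻ t : ℝ, ∫⁻ y : (ℝ ∙ u)ᗮ, f (y + t • u) ∂stdVol (ℝ ∙ u)ᗮ := by
  have h := measurePreserving_hyperplane hu
  rw [← h.lintegral_comp hf, lintegral_prod]
  exact (hf.comp h.measurable).aemeasurable

lemma stdVol_hyperplane {u : E} (hu : ‖u‖ = 1) {S : Set E} (hS : MeasurableSet S) :
    stdVol E S = ∫⁻ y : (ℝ ∙ u)ᗮ, volume {t : ℝ | (y : E) + t • u ∈ S} ∂stdVol (ℝ ∙ u)ᗮ := by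
  have h := measurePreserving_hyperplane hu
  rw [← h.measure_preimage hS.nullMeasurableSet, Measure.prod_apply_symm (h.measurable hS)]
  rfl

lemma lintegral_gamma (n : ℕ) :
    ∫⁻ s in Set.Ioi (0 : ℝ), ENNReal.ofReal (Real.exp (-s) * s ^ n) = (n ! : ℝ≥0∞) := by
  have h1 := Real.GammaIntegral_convergent (s := n + 1) (by positivity)
  have h2 := Real.Gamma_eq_integral (s := n + 1) (by positivity)
  rw [Real.Gamma_nat_eq_factorial] at h2
  simp only [add_sub_cancel_right, Real.rpow_natCast] at h1 h2
  rw [← ofReal_integral_eq_lintegral_ofReal h1, ← h2]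
  · simp
  · filter_upwards [self_mem_ae_restrict measurableSet_Ioi] with s hs
    have : (0 : ℝ) < s := hs
    positivity

/-- The integral of `exp (-M)` for a positively homogeneous `M`. -/
lemma lintegral_exp_neg_of_homogeneous {M : E → ℝ} (hM : Measurable M) (h0 : ∀ x, 0 ≤ M x)
    (hs : ∀ r : ℝ, 0 < r → ∀ x, M (r • x) = r * M x) :
    ∫⁻ x, ENNReal.ofReal (Real.exp (-M x)) ∂stdVol E
      = ((Module.finrank ℝ E) ! : ℝ≥0∞) * stdVol E {x | M x ≤ 1} := by
  set n := Module.finrank ℝ E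
  -- Write exp(-M x) as the integral of exp(-s) over s ≥ M x and swap; the set {M ≤ s} is s times {M
  -- ≤ 1}, which leaves a Gamma integral.
  have e1 : ∀ x, ENNReal.ofReal (Real.exp (-M x)) =
      ∫⁻ s in Set.Ioi (0 : ℝ), {p : E × ℝ | M p.1 ≤ p.2}.indicator
        (fun p => ENNReal.ofReal (Real.exp (-p.2))) (x, s) := by
    intro x
    have hi := integrableOn_exp_neg_Ioi (M x)
    rw [← integral_exp_neg_Ioi, ofReal_integral_eq_lintegral_ofReal hi
      (ae_of_all _ fun s => (Real.exp_pos _).le)]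
    rw [setLIntegral_congr Ioi_ae_eq_Ici, setLIntegral_congr Ioi_ae_eq_Ici,
      ← lintegral_indicator measurableSet_Ici, ← lintegral_indicator measurableSet_Ici]
    refine lintegral_congr fun s => ?_
    by_cases hs : M x ≤ s
    · have : 0 ≤ s := (h0 x).trans hs
      simp [hs, this]
    · simp [Set.indicator, hs]
  have hmeas : MeasurableSet {p : E × ℝ | M p.1 ≤ p.2} :=
    measurableSet_le (hM.comp measurable_fst) measurable_snd
  simp_rw [e1]
  rw [lintegral_lintegral_swap (f := fun x s => {p : E × ℝ | M p.1 ≤ p.2}.indicator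
        (fun p => ENNReal.ofReal (Real.exp (-p.2))) (x, s))
    ((Measurable.indicator (by fun_prop) hmeas).aemeasurable)]
  have e2 : ∀ s ∈ Set.Ioi (0 : ℝ), ∫⁻ x, {p : E × ℝ | M p.1 ≤ p.2}.indicator
        (fun p => ENNReal.ofReal (Real.exp (-p.2))) (x, s) ∂stdVol E
      = ENNReal.ofReal (Real.exp (-s) * s ^ n) * stdVol E {x | M x ≤ 1} := by
    intro s hs0
    have hs0 : 0 < s := hs0
    have : ∀ x, {p : E × ℝ | M p.1 ≤ p.2}.indicator
        (fun p => ENNReal.ofReal (Real.exp (-p.2))) (x, s)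
        = {x | M x ≤ s}.indicator (fun _ => ENNReal.ofReal (Real.exp (-s))) x := fun x => rfl
    simp_rw [this]
    rw [lintegral_indicator (measurableSet_le hM measurable_const), lintegral_const,
      Measure.restrict_apply_univ]
    have hsc : {x | M x ≤ s} = s • {x | M x ≤ 1} := by
      ext x
      rw [Set.mem_smul_set_iff_inv_smul_mem₀ hs0.ne']
      simp only [Set.mem_ofPred_eq]
      rw [hs _ (inv_pos.2 hs0), inv_mul_le_iff₀ hs0, mul_one]
    rw [hsc, Measure.addHaar_smul, abs_of_pos (by positivity), ENNReal.ofReal_mul (by positivity),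
      mul_assoc]
  rw [setLIntegral_congr_fun measurableSet_Ioi e2, lintegral_mul_const _ (by fun_prop),
    lintegral_gamma]

end StdVol

/-! ### Norms, dual balls and exponential integrals -/

section NormFn

variable {E : Type*} [NormedAddCommGroup E] [InnerProductSpace ℝ E]

/-- A function that is a norm equivalent to the given one. -/
structure IsNormFn (N : E → ℝ) : Prop where
  add_le : ∀ x y, N (x + y) ≤ N x + N y
  smul : ∀ (r : ℝ) x, N (r • x) = |r| * N x
  exists_lower : ∃ c > 0, ∀ x, c * ‖x‖ ≤ N x
  exists_upper : ∃ C > 0, ∀ x, N x ≤ C * ‖x‖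

/-- The unit ball of the dual norm, identified with a subset of `E`. -/
def dualBall (N : E → ℝ) : Set E := {z | ∀ x, ⟪x, z⟫ ≤ N x}

lemma dualBall_mono {N M : E → ℝ} (h : ∀ x, N x ≤ M x) : dualBall N ⊆ dualBall M :=
  fun _ hz x => (hz x).trans (h x)

namespace IsNormFn

variable {N : E → ℝ} (hN : IsNormFn N)

include hN

lemma nonneg (x : E) : 0 ≤ N x := by
  obtain ⟨c, hc, h⟩ := hN.exists_lower
  exact (by positivity : 0 ≤ c * ‖x‖).trans (h x)

lemma map_zero : N 0 = 0 := by simpa using hN.smul 0 0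

lemma map_neg (x : E) : N (-x) = N x := by simpa using hN.smul (-1) x

lemma smul_of_nonneg {r : ℝ} (hr : 0 ≤ r) (x : E) : N (r • x) = r * N x := by
  rw [hN.smul, abs_of_nonneg hr]

lemma eq_zero {x : E} (h : N x = 0) : x = 0 := by
  obtain ⟨c, hc, hl⟩ := hN.exists_lower
  have := hl x
  rw [h] at this
  have h2 : ‖x‖ ≤ 0 := by
    by_contra hx
    push Not at hx
    nlinarith [mul_pos hc hx]
  simpa using h2

lemma le_add_sub (x y : E) : N x ≤ N y + N (x - y) := by
  simpa using hN.add_le y (x - y)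

lemma continuous : Continuous N := by
  obtain ⟨C, hC, h⟩ := hN.exists_upper
  refine (LipschitzWith.of_le_add_mul (K := C.toNNReal) (f := N) fun x y => ?_).continuous
  rw [Real.coe_toNNReal _ hC.le, dist_eq_norm]
  exact (hN.le_add_sub x y).trans (by gcongr; exact h _)

lemma restrict (F : Submodule ℝ E) : IsNormFn (fun y : F => N y) where
  add_le x y := hN.add_le x y
  smul r x := hN.smul r x
  exists_lower := by
    obtain ⟨c, hc, h⟩ := hN.exists_lower
    exact ⟨c, hc, fun x => h x⟩
  exists_upper := by
    obtain ⟨c, hc, h⟩ := hN.exists_upper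
    exact ⟨c, hc, fun x => h x⟩

lemma const_mul {r : ℝ} (hr : 0 < r) : IsNormFn (fun x => r * N x) where
  add_le x y := by rw [← mul_add]; exact mul_le_mul_of_nonneg_left (hN.add_le x y) hr.le
  smul s x := by rw [hN.smul]; ring
  exists_lower := by
    obtain ⟨c, hc, h⟩ := hN.exists_lower
    exact ⟨r * c, by positivity, fun x => by rw [mul_assoc]; gcongr; exact h x⟩
  exists_upper := by
    obtain ⟨c, hc, h⟩ := hN.exists_upper
    exact ⟨r * c, by positivity, fun x => by rw [mul_assoc]; gcongr; exact h x⟩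

lemma add_abs_inner {r : ℝ} (hr : 0 ≤ r) (w : E) : IsNormFn (fun x => N x + r * |⟪x, w⟫|) where
  add_le x y := by
    have h1 := hN.add_le x y
    have h2 : |⟪x + y, w⟫| ≤ |⟪x, w⟫| + |⟪y, w⟫| := by
      rw [inner_add_left]; exact abs_add_le _ _
    nlinarith [mul_le_mul_of_nonneg_left h2 hr]
  smul s x := by
    rw [hN.smul, real_inner_smul_left, abs_mul]; ring
  exists_lower := by
    obtain ⟨c, hc, h⟩ := hN.exists_lower
    exact ⟨c, hc, fun x => (h x).trans (le_add_of_nonneg_right (by positivity))⟩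
  exists_upper := by
    obtain ⟨c, hc, h⟩ := hN.exists_upper
    refine ⟨c + r * ‖w‖, by positivity, fun x => ?_⟩
    have := mul_le_mul_of_nonneg_left (abs_real_inner_le_norm x w) hr
    have := h x
    linarith

omit hN in
lemma isClosed_dualBall : IsClosed (dualBall N) := by
  have : dualBall N = ⋂ x, {z | ⟪x, z⟫ ≤ N x} := by ext; simp [dualBall]
  rw [this]
  exact isClosed_iInter fun x => isClosed_le (by fun_prop) continuous_const

lemma norm_le_of_mem_dualBall : ∃ R > 0, ∀ z ∈ dualBall N, ‖z‖ ≤ R := by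
  obtain ⟨C, hC, h⟩ := hN.exists_upper
  refine ⟨C, hC, fun z hz => ?_⟩
  by_contra hlt
  push Not at hlt
  have h1 := (hz z).trans (h z)
  rw [real_inner_self_eq_norm_sq] at h1
  nlinarith

lemma exists_ball_subset_dualBall : ∃ r > 0, Metric.ball 0 r ⊆ dualBall N := by
  obtain ⟨c, hc, h⟩ := hN.exists_lower
  refine ⟨c, hc, fun z hz x => ?_⟩
  rw [mem_ball_zero_iff] at hz
  refine (real_inner_le_norm x z).trans (le_trans ?_ (h x))
  rw [mul_comm]
  gcongr

omit hN in
lemma dualBall_const_mul {r : ℝ} (hr : 0 < r) : dualBall (fun x => r * N x) = r • dualBall N := by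
  ext z
  rw [Set.mem_smul_set_iff_inv_smul_mem₀ hr.ne']
  simp only [dualBall, Set.mem_ofPred_eq, real_inner_smul_right]
  exact forall_congr' fun x => by rw [inv_mul_le_iff₀ hr]

variable [FiniteDimensional ℝ E]

lemma isCompact_dualBall : IsCompact (dualBall N) := by
  obtain ⟨R, -, h⟩ := hN.norm_le_of_mem_dualBall
  exact (isCompact_closedBall (0 : E) R).of_isClosed_subset isClosed_dualBall
    fun z hz => by simpa using h z hz

variable [MeasurableSpace E] [BorelSpace E]

lemma stdVol_dualBall_ne_top : stdVol E (dualBall N) ≠ ∞ :=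
  hN.isCompact_dualBall.measure_lt_top.ne

lemma stdVol_dualBall_ne_zero : stdVol E (dualBall N) ≠ 0 := by
  obtain ⟨r, hr, h⟩ := hN.exists_ball_subset_dualBall
  exact ((Metric.measure_ball_pos (stdVol E) 0 hr).trans_le (measure_mono h)).ne'

omit [FiniteDimensional ℝ E] in
lemma measurable : Measurable N := hN.continuous.measurable

end IsNormFn

variable [FiniteDimensional ℝ E] [MeasurableSpace E] [BorelSpace E]

lemma stdVol_smul_of_pos {r : ℝ} (hr : 0 < r) (S : Set E) :
    stdVol E (r • S) = ENNReal.ofReal (r ^ Module.finrank ℝ E) * stdVol E S := by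
  rw [Measure.addHaar_smul, abs_of_pos (by positivity)]

/-- The integral of `exp (-N)`. -/
noncomputable def expInt (N : E → ℝ) : ℝ≥0∞ := ∫⁻ x, ENNReal.ofReal (Real.exp (-N x)) ∂stdVol E

/-- The first absolute moment in direction `u` of the measure with density `exp (-N)`. -/
noncomputable def expMoment (N : E → ℝ) (u : E) : ℝ≥0∞ :=
  ∫⁻ x, ENNReal.ofReal (|⟪x, u⟫| * Real.exp (-N x)) ∂stdVol E

namespace IsNormFn

variable {N : E → ℝ} (hN : IsNormFn N)

include hN

lemma expInt_eq : expInt N = ((Module.finrank ℝ E) ! : ℝ≥0∞) * stdVol E {x | N x ≤ 1} :=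
  lintegral_exp_neg_of_homogeneous hN.measurable hN.nonneg fun _ hr x => hN.smul_of_nonneg hr.le x

lemma expInt_ne_top : expInt N ≠ ∞ := by
  rw [hN.expInt_eq]
  refine ENNReal.mul_ne_top (ENNReal.natCast_ne_top _) ?_
  obtain ⟨c, hc, h⟩ := hN.exists_lower
  refine ((measure_mono fun x hx => ?_).trans_lt
    (measure_closedBall_lt_top (μ := stdVol E) (x := 0) (r := c⁻¹))).ne
  rw [mem_closedBall_zero_iff]
  have hx : N x ≤ 1 := hx
  rw [← one_div, le_div_iff₀ hc, mul_comm]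
  exact (h x).trans hx

lemma expInt_ne_zero : expInt N ≠ 0 := by
  rw [hN.expInt_eq]
  refine mul_ne_zero (by exact_mod_cast (Nat.factorial_pos _).ne') ?_
  obtain ⟨c, hc, h⟩ := hN.exists_upper
  refine ((Metric.measure_ball_pos (stdVol E) 0 (inv_pos.2 hc)).trans_le
    (measure_mono fun x hx => ?_)).ne'
  rw [mem_ball_zero_iff, ← one_div, lt_div_iff₀ hc, mul_comm] at hx
  exact (h x).trans hx.le

lemma expInt_const_mul {r : ℝ} (hr : 0 < r) :
    expInt N = ENNReal.ofReal (r ^ Module.finrank ℝ E) * expInt (fun x => r * N x) := by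
  rw [(hN.const_mul hr).expInt_eq, hN.expInt_eq]
  have : {x | N x ≤ 1} = r • {x | r * N x ≤ 1} := by
    ext x
    rw [Set.mem_smul_set_iff_inv_smul_mem₀ hr.ne']
    simp only [Set.mem_ofPred_eq]
    rw [hN.smul_of_nonneg (inv_pos.2 hr).le, mul_inv_cancel_left₀ hr.ne']
  rw [this, stdVol_smul_of_pos hr]
  ring

/-- Half of the exponential absorbs the factor ‖x‖, since c‖x‖ ≤ N ≤ 2 exp(N/2). -/
lemma lintegral_norm_mul_exp_ne_top :
    ∫⁻ x, ENNReal.ofReal (‖x‖ * Real.exp (-N x)) ∂stdVol E ≠ ∞ := by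
  obtain ⟨c, hc, h⟩ := hN.exists_lower
  have h2 : IsNormFn fun x => (1 / 2) * N x := hN.const_mul (by norm_num)
  refine ((lintegral_mono (g := fun x => ENNReal.ofReal (2 / c) *
    ENNReal.ofReal (Real.exp (-(1 / 2 * N x)))) fun x => ?_).trans_lt ?_).ne
  · change _ ≤ ENNReal.ofReal _ * ENNReal.ofReal _
    rw [← ENNReal.ofReal_mul (by positivity)]
    refine ENNReal.ofReal_le_ofReal ?_
    have e : Real.exp (-N x) = Real.exp (-(1 / 2 * N x)) * Real.exp (-(1 / 2 * N x)) := by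
      rw [← Real.exp_add]; ring_nf
    have h3 : N x ≤ 2 * Real.exp (1 / 2 * N x) := by
      have := Real.add_one_le_exp (1 / 2 * N x); linarith
    have h4 : ‖x‖ * Real.exp (-(1 / 2 * N x)) ≤ 2 / c := by
      rw [Real.exp_neg, ← div_eq_mul_inv, div_le_div_iff₀ (Real.exp_pos _) hc]
      linarith [h x, mul_comm c ‖x‖]
    rw [e, ← mul_assoc]
    gcongr
  · rw [lintegral_const_mul' _ _ ENNReal.ofReal_ne_top]
    exact ENNReal.mul_lt_top ENNReal.ofReal_lt_top h2.expInt_ne_top.lt_top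

/-- A Lipschitz bound in the direction, needed when a sequence of directions converges. -/
lemma expMoment_le_add (u v : E) : expMoment N v ≤ expMoment N u +
    ENNReal.ofReal ‖v - u‖ * ∫⁻ x, ENNReal.ofReal (‖x‖ * Real.exp (-N x)) ∂stdVol E := by
  have hm := hN.measurable
  rw [← lintegral_const_mul' _ _ ENNReal.ofReal_ne_top, expMoment, expMoment,
    ← lintegral_add_left (by fun_prop)]
  refine lintegral_mono fun x => ?_
  rw [← ENNReal.ofReal_mul (norm_nonneg _), ← ENNReal.ofReal_add (by positivity) (by positivity)]
  refine ENNReal.ofReal_le_ofReal ?_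
  rw [← mul_assoc, ← add_mul]
  gcongr
  calc |⟪x, v⟫| = |⟪x, u⟫ + ⟪x, v - u⟫| := by rw [← inner_add_right]; simp
    _ ≤ |⟪x, u⟫| + ‖v - u‖ * ‖x‖ := by
      refine (abs_add_le _ _).trans (add_le_add_right ?_ _)
      rw [mul_comm]; exact abs_real_inner_le_norm _ _

lemma expMoment_ne_top (u : E) : expMoment N u ≠ ∞ := by
  refine ((hN.expMoment_le_add 0 u).trans_lt ?_).ne
  have h0 : expMoment N (0 : E) = 0 := by simp [expMoment]
  rw [h0, zero_add]
  exact ENNReal.mul_lt_top ENNReal.ofReal_lt_top hN.lintegral_norm_mul_exp_ne_top.lt_top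

/-- The first moment of `N` for the density `exp (-N)` is at least `n` times the mass. -/
lemma finrank_mul_expInt_le :
    (Module.finrank ℝ E : ℝ≥0∞) * expInt N
      ≤ ∫⁻ x, ENNReal.ofReal (N x * Real.exp (-N x)) ∂stdVol E := by
  set n := Module.finrank ℝ E
  set J := ∫⁻ x, ENNReal.ofReal (N x * Real.exp (-N x)) ∂stdVol E with hJ
  by_cases hJt : J = ∞
  · simp [hJt]
  have hI := hN.expInt_ne_top
  -- A finite-ε form of differentiating ∫ exp(-(1+ε)N) = (1+ε)^(-n) ∫ exp(-N) at ε = 0, from 1 - εN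
  -- ≤ exp(-εN) and Bernoulli.
  have key : ∀ ε : ℝ, 0 < ε → n * (expInt N).toReal ≤ (1 + ε) ^ n * J.toReal := by
    intro ε hε
    have h1 : expInt N ≤ ENNReal.ofReal ε * J + expInt (fun x => (1 + ε) * N x) := by
      have hm := hN.measurable
      rw [hJ, ← lintegral_const_mul' _ _ ENNReal.ofReal_ne_top, expInt, expInt,
        ← lintegral_add_left (by fun_prop)]
      refine lintegral_mono fun x => ?_
      have := hN.nonneg x
      rw [← ENNReal.ofReal_mul hε.le, ← ENNReal.ofReal_add (by positivity) (by positivity)]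
      refine ENNReal.ofReal_le_ofReal ?_
      have e : Real.exp (-((1 + ε) * N x)) = Real.exp (-N x) * Real.exp (-(ε * N x)) := by
        rw [← Real.exp_add]; ring_nf
      rw [e]
      have := Real.add_one_le_exp (-(ε * N x))
      nlinarith [Real.exp_pos (-N x), mul_le_mul_of_nonneg_left this (Real.exp_pos (-N x)).le]
    have h2 := hN.expInt_const_mul (r := 1 + ε) (by positivity)
    set I' := expInt (fun x => (1 + ε) * N x)
    have hI' : I' ≠ ∞ := (hN.const_mul (by positivity)).expInt_ne_top
    have h1' := ENNReal.toReal_mono (by finiteness) h1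
    rw [ENNReal.toReal_add (by finiteness) hI', ENNReal.toReal_mul,
      ENNReal.toReal_ofReal hε.le] at h1'
    have h2' := congrArg ENNReal.toReal h2
    rw [ENNReal.toReal_mul, ENNReal.toReal_ofReal (by positivity)] at h2'
    have hb := one_add_mul_le_pow (a := ε) (by linarith) n
    have hpos : (0 : ℝ) ≤ (1 + ε) ^ n := by positivity
    have hIr : 0 ≤ (expInt N).toReal := ENNReal.toReal_nonneg
    have : ε * (n * (expInt N).toReal) ≤ ε * ((1 + ε) ^ n * J.toReal) := by
      nlinarith [mul_le_mul_of_nonneg_left h1' hpos, mul_le_mul_of_nonneg_right hb hIr]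
    exact le_of_mul_le_mul_left this hε
  have hlim : Tendsto (fun ε : ℝ => (1 + ε) ^ n * J.toReal) (𝓝[>] 0) (𝓝 ((1 + 0) ^ n * J.toReal)) :=
    (Continuous.tendsto (by fun_prop) 0).mono_left nhdsWithin_le_nhds
  have := ge_of_tendsto hlim (by filter_upwards [self_mem_nhdsWithin] with ε hε using key ε hε)
  rw [← ENNReal.ofReal_toReal hJt, ← ENNReal.ofReal_toReal hI, ← ENNReal.ofReal_natCast,
    ← ENNReal.ofReal_mul (by positivity)]
  exact ENNReal.ofReal_le_ofReal (by simpa using this)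

end IsNormFn

end NormFn

/-! ### The slice function and its moment inequality -/

lemma lintegral_eq_two_mul_of_even {f : ℝ → ℝ≥0∞} (hf : ∀ t, f (-t) = f t) :
    ∫⁻ t, f t = 2 * ∫⁻ t in Set.Ioi 0, f t := by
  have h : ∫⁻ t in Set.Iic 0, f t = ∫⁻ t in Set.Ioi 0, f t := by
    have mp := (Measure.measurePreserving_neg (volume : Measure ℝ)).setLIntegral_comp_preimage_emb
      (MeasurableEquiv.neg ℝ).measurableEmbedding f (Set.Iic 0)
    rw [← mp, setLIntegral_congr Ioi_ae_eq_Ici]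
    simp [hf]
  rw [two_mul]
  nth_rw 1 [← h]
  rw [← lintegral_add_compl f measurableSet_Iic (A := Set.Iic 0), Set.compl_Iic]

/-- The weight r is the length of (0, r); substitute r = s + t. A first moment thus becomes a
quadrant integral, comparable with the square of an integral. -/
lemma lintegral_mul_eq_lintegral_lintegral_add {f : ℝ → ℝ≥0∞} (hf : Measurable f) :
    ∫⁻ t in Set.Ioi 0, ENNReal.ofReal t * f t
      = ∫⁻ s in Set.Ioi 0, ∫⁻ t in Set.Ioi 0, f (s + t) := by
  have h1 : ∀ s ∈ Set.Ioi (0 : ℝ), ∫⁻ t in Set.Ioi 0, f (s + t)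
      = ∫⁻ r in Set.Ioi 0, (Set.Ioo 0 r).indicator (fun _ => f r) s := by
    intro s hs
    have hs : 0 < s := hs
    have e := lintegral_add_left_eq_self (μ := volume) ((Set.Ioi s).indicator f) s
    rw [lintegral_indicator measurableSet_Ioi] at e
    rw [← lintegral_indicator measurableSet_Ioi, ← lintegral_indicator measurableSet_Ioi]
    have e1 : ∀ t, (Set.Ioi s).indicator f (s + t)
        = (Set.Ioi 0).indicator (fun t => f (s + t)) t := fun t => by simp [Set.indicator]
    simp_rw [← e1]
    rw [e, ← lintegral_indicator measurableSet_Ioi]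
    refine lintegral_congr fun r => ?_
    by_cases hr : s < r
    · simp [Set.indicator, hr, hs, hs.trans hr]
    · simp [Set.indicator, hr]
  rw [setLIntegral_congr_fun measurableSet_Ioi h1, lintegral_lintegral_swap]
  · refine setLIntegral_congr_fun measurableSet_Ioi fun r hr => ?_
    rw [lintegral_indicator measurableSet_Ioo, lintegral_const, Measure.restrict_restrict
      measurableSet_Ioo, Measure.restrict_apply_univ, Set.inter_eq_left.2 Set.Ioo_subset_Ioi_self]
    simp [mul_comm]
  · have hm : MeasurableSet {p : ℝ × ℝ | 0 < p.1 ∧ p.1 < p.2} :=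
      (measurableSet_lt measurable_const measurable_fst).inter
        (measurableSet_lt measurable_fst measurable_snd)
    have : (Function.uncurry fun s r => (Set.Ioo 0 r).indicator (fun _ => f r) s)
        = {p : ℝ × ℝ | 0 < p.1 ∧ p.1 < p.2}.indicator (fun p => f p.2) := rfl
    rw [this]
    exact ((hf.comp measurable_snd).indicator hm).aemeasurable

section Slice

variable {E : Type*} [NormedAddCommGroup E] [InnerProductSpace ℝ E]
  [FiniteDimensional ℝ E] [MeasurableSpace E] [BorelSpace E]

/-- The integral of `exp (-N)` over the hyperplane at height `t` in direction `u`. -/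
noncomputable def expSlice (N : E → ℝ) (u : E) (t : ℝ) : ℝ≥0∞ :=
  ∫⁻ y : (ℝ ∙ u)ᗮ, ENNReal.ofReal (Real.exp (-N (y + t • u))) ∂stdVol (ℝ ∙ u)ᗮ

omit [FiniteDimensional ℝ E] [MeasurableSpace E] [BorelSpace E] in
lemma inner_hyperplane {u : E} (hu : ‖u‖ = 1) (y : (ℝ ∙ u)ᗮ) (t : ℝ) :
    ⟪(y : E) + t • u, u⟫ = t := by
  have : ⟪(y : E), u⟫ = 0 := by
    rw [real_inner_comm]
    exact Submodule.mem_orthogonal_singleton_iff_inner_right.1 y.2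
  rw [inner_add_left, this, real_inner_smul_left, real_inner_self_eq_norm_sq, hu]
  ring

namespace IsNormFn

variable {N : E → ℝ} (hN : IsNormFn N)

include hN

lemma measurable_exp_hyperplane (u : E) : Measurable fun p : ℝ × (ℝ ∙ u)ᗮ =>
    ENNReal.ofReal (Real.exp (-N (p.2 + p.1 • u))) := by
  have := hN.continuous
  exact (ENNReal.continuous_ofReal.comp (by fun_prop : Continuous fun p : ℝ × (ℝ ∙ u)ᗮ =>
    Real.exp (-N (p.2 + p.1 • u)))).measurable

lemma measurable_expSlice (u : E) : Measurable (expSlice N u) :=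
  (hN.measurable_exp_hyperplane u).lintegral_prod_right'

lemma expInt_eq_lintegral_expSlice {u : E} (hu : ‖u‖ = 1) :
    expInt N = ∫⁻ t, expSlice N u t :=
  lintegral_hyperplane hu (hN.measurable.neg.exp.ennreal_ofReal)

omit hN in
lemma expSlice_zero (u : E) : expSlice N u 0 = expInt (fun y : (ℝ ∙ u)ᗮ => N y) := by
  simp [expSlice, expInt]

lemma expSlice_neg (u : E) (t : ℝ) : expSlice N u (-t) = expSlice N u t := by
  have := (Measure.measurePreserving_neg (stdVol (ℝ ∙ u)ᗮ)).lintegral_comp_emb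
    (MeasurableEquiv.neg _).measurableEmbedding
    (fun y : (ℝ ∙ u)ᗮ => ENNReal.ofReal (Real.exp (-N (y + t • u))))
  rw [expSlice, expSlice, ← this]
  refine lintegral_congr fun y => ?_
  rw [← hN.map_neg]
  simp [add_comm]

lemma expMoment_eq {u : E} (hu : ‖u‖ = 1) :
    expMoment N u = ∫⁻ t, ENNReal.ofReal |t| * expSlice N u t := by
  have := hN.measurable
  rw [expMoment, lintegral_hyperplane hu (by fun_prop)]
  refine lintegral_congr fun t => ?_
  rw [expSlice, ← lintegral_const_mul' _ _ ENNReal.ofReal_ne_top]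
  refine lintegral_congr fun y => ?_
  rw [inner_hyperplane hu, ENNReal.ofReal_mul (abs_nonneg _)]

/-- Shifting the hyperplane by t - s changes N by at most |t - s| N(u). Finiteness, positivity and
continuity of the slice function all follow. -/
lemma expSlice_le (u : E) (s t : ℝ) :
    expSlice N u t ≤ ENNReal.ofReal (Real.exp (|t - s| * N u)) * expSlice N u s := by
  rw [expSlice, expSlice, ← lintegral_const_mul' _ _ ENNReal.ofReal_ne_top]
  refine lintegral_mono fun y => ?_
  rw [← ENNReal.ofReal_mul (by positivity), ← Real.exp_add]
  refine ENNReal.ofReal_le_ofReal (Real.exp_le_exp.2 ?_)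
  have := hN.le_add_sub (y + s • u) (y + t • u)
  have e : (y + s • u) - (y + t • u) = (s - t) • u := by module
  rw [e, hN.smul, abs_sub_comm] at this
  linarith

lemma expSlice_ne_top (u : E) (t : ℝ) : expSlice N u t ≠ ∞ := by
  refine ((hN.expSlice_le u 0 t).trans_lt (ENNReal.mul_lt_top ENNReal.ofReal_lt_top ?_)).ne
  rw [expSlice_zero]
  exact (hN.restrict _).expInt_ne_top.lt_top

lemma expSlice_ne_zero (u : E) (t : ℝ) : expSlice N u t ≠ 0 := by
  intro h
  have := hN.expSlice_le u t 0
  rw [h, mul_zero, expSlice_zero] at this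
  exact (hN.restrict _).expInt_ne_zero (nonpos_iff_eq_zero.1 this)

/-- Log-concavity between the heights 0 and r: Prékopa-Leindler applied to exp(-N), with N convex.
-/
lemma expSlice_zero_rpow_mul_le (u : E) {a b : ℝ} (ha : 0 < a) (hb : 0 < b) (hab : a + b = 1)
    (r : ℝ) : expSlice N u 0 ^ a * expSlice N u r ^ b ≤ expSlice N u (b * r) := by
  have hm : ∀ t, Measurable fun y : (ℝ ∙ u)ᗮ => ENNReal.ofReal (Real.exp (-N (y + t • u))) :=
    fun t => (hN.measurable_exp_hyperplane u).comp measurable_prodMk_left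
  refine prekopa_leindler (hm 0) (hm r) (hm _) ha hb hab fun x y => ?_
  rw [ENNReal.ofReal_rpow_of_pos (Real.exp_pos _), ENNReal.ofReal_rpow_of_pos (Real.exp_pos _),
    ← ENNReal.ofReal_mul (by positivity), ← Real.exp_mul, ← Real.exp_mul, ← Real.exp_add]
  refine ENNReal.ofReal_le_ofReal (Real.exp_le_exp.2 ?_)
  have h1 := hN.add_le (a • (x + (0 : ℝ) • u)) (b • (y + r • u))
  rw [hN.smul_of_nonneg ha.le, hN.smul_of_nonneg hb.le] at h1
  have e : a • (x + (0 : ℝ) • u) + b • (y + r • u)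
      = ((a • x + b • y : (ℝ ∙ u)ᗮ) : E) + (b * r) • u := by
    push_cast; module
  rw [e] at h1
  linarith

/-- Both s and t are convex combinations of 0 and s + t with complementary weights; multiply the two
log-concavity bounds. -/
lemma expSlice_zero_mul_le (u : E) {s t : ℝ} (hs : 0 < s) (ht : 0 < t) :
    expSlice N u 0 * expSlice N u (s + t) ≤ expSlice N u s * expSlice N u t := by
  set a := t / (s + t)
  set b := s / (s + t)
  have ha : 0 < a := by positivity
  have hb : 0 < b := by positivity
  have hab : a + b = 1 := by simp only [a, b]; field_simp; ring
  have h1 := hN.expSlice_zero_rpow_mul_le u ha hb hab (s + t)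
  have h2 := hN.expSlice_zero_rpow_mul_le u hb ha (by linarith) (s + t)
  rw [show b * (s + t) = s by simp only [b]; field_simp] at h1
  rw [show a * (s + t) = t by simp only [a]; field_simp] at h2
  refine le_trans (le_of_eq ?_) (mul_le_mul' h1 h2)
  rw [mul_mul_mul_comm, ← ENNReal.rpow_add _ _ (hN.expSlice_ne_zero u 0) (hN.expSlice_ne_top u 0),
    ← ENNReal.rpow_add _ _ (hN.expSlice_ne_zero u _) (hN.expSlice_ne_top u _), hab, add_comm b a,
    hab, ENNReal.rpow_one, ENNReal.rpow_one]

lemma expInt_eq_two_mul {u : E} (hu : ‖u‖ = 1) :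
    expInt N = 2 * ∫⁻ t in Set.Ioi 0, expSlice N u t := by
  rw [hN.expInt_eq_lintegral_expSlice hu, lintegral_eq_two_mul_of_even (hN.expSlice_neg u)]

lemma expMoment_eq_two_mul {u : E} (hu : ‖u‖ = 1) :
    expMoment N u = 2 * ∫⁻ s in Set.Ioi 0, ∫⁻ t in Set.Ioi 0, expSlice N u (s + t) := by
  rw [hN.expMoment_eq hu, lintegral_eq_two_mul_of_even
    (fun t => by rw [abs_neg, hN.expSlice_neg]),
    ← lintegral_mul_eq_lintegral_lintegral_add (hN.measurable_expSlice u)]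
  congr 1
  refine setLIntegral_congr_fun measurableSet_Ioi fun t ht => ?_
  rw [abs_of_pos ht]

lemma expSlice_zero_mul_expMoment {u : E} (hu : ‖u‖ = 1) :
    expSlice N u 0 * expMoment N u = 2 * ∫⁻ p : ℝ × ℝ, expSlice N u 0 * expSlice N u (p.1 + p.2)
      ∂(volume.restrict (Set.Ioi 0)).prod (volume.restrict (Set.Ioi 0)) := by
  have := hN.measurable_expSlice u
  rw [lintegral_const_mul _ (by fun_prop), lintegral_prod _ (by fun_prop),
    hN.expMoment_eq_two_mul hu]
  ring

lemma expInt_sq {u : E} (hu : ‖u‖ = 1) :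
    expInt N ^ 2 = 4 * ∫⁻ p : ℝ × ℝ, expSlice N u p.1 * expSlice N u p.2
      ∂(volume.restrict (Set.Ioi 0)).prod (volume.restrict (Set.Ioi 0)) := by
  have := hN.measurable_expSlice u
  rw [lintegral_prod_mul this.aemeasurable this.aemeasurable, hN.expInt_eq_two_mul hu]
  ring

omit hN in
lemma ae_prod_Ioi {p : ℝ × ℝ → Prop} (h : ∀ s > 0, ∀ t > 0, p (s, t)) :
    ∀ᵐ q ∂((volume : Measure ℝ).restrict (Set.Ioi 0)).prod
      ((volume : Measure ℝ).restrict (Set.Ioi 0)), p q := by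
  rw [Measure.prod_restrict]
  filter_upwards [self_mem_ae_restrict (measurableSet_Ioi.prod measurableSet_Ioi)] with q hq
  exact h q.1 hq.1 q.2 hq.2

/-- The moment inequality `2 F(0) ∫ |t| F ≤ (∫ F)²` for the slice function `F`. -/
lemma two_mul_expSlice_zero_mul_expMoment_le {u : E} (hu : ‖u‖ = 1) :
    2 * (expSlice N u 0 * expMoment N u) ≤ expInt N ^ 2 := by
  rw [hN.expSlice_zero_mul_expMoment hu, hN.expInt_sq hu, ← mul_assoc]
  norm_num
  refine mul_le_mul_right ?_ _
  exact lintegral_mono_ae (ae_prod_Ioi (p := fun p : ℝ × ℝ =>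
    expSlice N u 0 * expSlice N u (p.1 + p.2) ≤ expSlice N u p.1 * expSlice N u p.2) fun s hs t ht => hN.expSlice_zero_mul_le u hs ht)

lemma continuous_expSlice (u : E) : Continuous (expSlice N u) := by
  rw [continuous_iff_continuousAt]
  intro s
  have h1 : Tendsto (fun t => ENNReal.ofReal (Real.exp (-(|t - s| * N u))) * expSlice N u s)
      (𝓝 s) (𝓝 (expSlice N u s)) := by
    have : Tendsto (fun t => ENNReal.ofReal (Real.exp (-(|t - s| * N u)))) (𝓝 s) (𝓝 1) := by
      simpa using ENNReal.tendsto_ofReal ((by fun_prop : Continuous fun t =>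
        Real.exp (-(|t - s| * N u))).tendsto s)
    simpa using ENNReal.Tendsto.mul_const this (Or.inl one_ne_zero)
  have h2 : Tendsto (fun t => ENNReal.ofReal (Real.exp (|t - s| * N u)) * expSlice N u s)
      (𝓝 s) (𝓝 (expSlice N u s)) := by
    have : Tendsto (fun t => ENNReal.ofReal (Real.exp (|t - s| * N u))) (𝓝 s) (𝓝 1) := by
      simpa using ENNReal.tendsto_ofReal ((by fun_prop : Continuous fun t =>
        Real.exp (|t - s| * N u)).tendsto s)
    simpa using ENNReal.Tendsto.mul_const this (Or.inl one_ne_zero)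
  refine tendsto_of_tendsto_of_tendsto_of_le_of_le h1 h2 (fun t => ?_)
    (fun t => hN.expSlice_le u s t)
  have := hN.expSlice_le u t s
  calc _ ≤ ENNReal.ofReal (Real.exp (-(|t - s| * N u))) *
        (ENNReal.ofReal (Real.exp (|s - t| * N u)) * expSlice N u t) := by gcongr
    _ = expSlice N u t := by
      rw [← mul_assoc, ← ENNReal.ofReal_mul (by positivity), ← Real.exp_add, abs_sub_comm]
      simp

/-- Equality in the moment inequality makes the slice function multiplicative. -/
lemma expSlice_zero_mul_eq {u : E} (hu : ‖u‖ = 1)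
    (heq : 2 * (expSlice N u 0 * expMoment N u) = expInt N ^ 2) {s t : ℝ} (hs : 0 < s)
    (ht : 0 < t) : expSlice N u 0 * expSlice N u (s + t) = expSlice N u s * expSlice N u t := by
  set μ := ((volume : Measure ℝ).restrict (Set.Ioi 0)).prod
      ((volume : Measure ℝ).restrict (Set.Ioi 0)) with hμ
  have hc := hN.continuous_expSlice u
  have hm := hN.measurable_expSlice u
  have hle : (fun p : ℝ × ℝ => expSlice N u 0 * expSlice N u (p.1 + p.2)) ≤ᵐ[μ]
      fun p => expSlice N u p.1 * expSlice N u p.2 :=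
    ae_prod_Ioi fun s hs t ht => hN.expSlice_zero_mul_le u hs ht
  have hsq := hN.expInt_sq hu
  have hfin : ∫⁻ p : ℝ × ℝ, expSlice N u 0 * expSlice N u (p.1 + p.2) ∂μ ≠ ∞ := by
    intro h
    have := hN.expSlice_zero_mul_expMoment hu
    rw [← hμ, h] at this
    refine ENNReal.mul_ne_top (hN.expSlice_ne_top u 0) (hN.expMoment_ne_top u) (this.trans ?_)
    simp
  have hint : ∫⁻ p : ℝ × ℝ, expSlice N u p.1 * expSlice N u p.2 ∂μ
      ≤ ∫⁻ p : ℝ × ℝ, expSlice N u 0 * expSlice N u (p.1 + p.2) ∂μ := by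
    rw [← heq, hN.expSlice_zero_mul_expMoment hu, ← mul_assoc] at hsq
    norm_num at hsq
    exact ((ENNReal.mul_right_inj (by norm_num) (by finiteness)).1 hsq).ge
  -- Ordered integrands with equal finite integrals agree a.e., and continuity upgrades this to the
  -- whole open quadrant.
  have hae := ae_eq_of_ae_le_of_lintegral_le hle hfin (by fun_prop) hint
  rw [hμ, Measure.prod_restrict] at hae
  have := Measure.eqOn_open_of_ae_eq hae (isOpen_Ioi.prod isOpen_Ioi) ?_ ?_
  · exact this (Set.mk_mem_prod hs ht : (s, t) ∈ _)
  · refine Continuous.continuousOn ?_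
    exact (ENNReal.continuous_const_mul (hN.expSlice_ne_top u 0)).comp (by fun_prop)
  · refine Continuous.continuousOn ?_
    rw [continuous_iff_continuousAt]
    intro p
    exact ENNReal.Tendsto.mul (hc.comp continuous_fst).continuousAt
      (Or.inl (hN.expSlice_ne_zero u _)) (hc.comp continuous_snd).continuousAt
      (Or.inl (hN.expSlice_ne_zero u _))

end IsNormFn

end Slice

/-! ### Projections of the dual ball and the two averaged inequalities -/

section Projection

variable {E : Type*} [NormedAddCommGroup E] [InnerProductSpace ℝ E]

lemma inner_orthogonal_eq_zero {u : E} (y : (ℝ ∙ u)ᗮ) : ⟪(y : E), u⟫ = 0 := by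
  rw [real_inner_comm]
  exact Submodule.mem_orthogonal_singleton_iff_inner_right.1 y.2

lemma exists_eq_add_inner_smul {u : E} (hu : ‖u‖ = 1) (x : E) :
    ∃ y : (ℝ ∙ u)ᗮ, x = y + ⟪x, u⟫ • u := by
  refine ⟨⟨x - ⟪x, u⟫ • u, ?_⟩, by simp⟩
  rw [Submodule.mem_orthogonal_singleton_iff_inner_right, inner_sub_right, real_inner_smul_right,
    real_inner_self_eq_norm_sq, hu, real_inner_comm]
  ring

lemma mem_dualBall_restrict {N : E → ℝ} {u : E} {z : (ℝ ∙ u)ᗮ} {t : ℝ}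
    (h : (z : E) + t • u ∈ dualBall N) : z ∈ dualBall (fun y : (ℝ ∙ u)ᗮ => N y) := by
  intro y
  have := h y
  rwa [inner_add_right, real_inner_smul_right, inner_orthogonal_eq_zero, mul_zero, add_zero] at this

/-- Every point of the dual ball of the restriction lifts to the dual ball. -/
lemma IsNormFn.exists_add_smul_mem_dualBall {N : E → ℝ} (hN : IsNormFn N) {u : E} (hu : ‖u‖ = 1)
    {z : (ℝ ∙ u)ᗮ} (hz : z ∈ dualBall (fun y : (ℝ ∙ u)ᗮ => N y)) :
    ∃ t : ℝ, (z : E) + t • u ∈ dualBall N := by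
  -- Hahn-Banach extends the functional given by z from the hyperplane, dominated by N; its value at
  -- u is the required height.
  obtain ⟨g, hg, hgN⟩ := exists_extension_of_le_sublinear
    (⟨(ℝ ∙ u)ᗮ, (innerₛₗ ℝ z)⟩ : E →ₗ.[ℝ] ℝ) N (fun r hr x => hN.smul_of_nonneg hr.le x)
    hN.add_le (fun y => by simpa [real_inner_comm] using hz y)
  refine ⟨g u, fun x => ?_⟩
  obtain ⟨y, hy⟩ := exists_eq_add_inner_smul hu x
  have h1 : g y = ⟪z, y⟫ := hg y
  have h2 : ⟪x, (z : E) + g u • u⟫ = g x := by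
    conv_rhs => rw [hy]
    rw [map_add, map_smul, h1, inner_add_right, real_inner_smul_right]
    nth_rw 1 [hy]
    rw [inner_add_left, real_inner_smul_left, real_inner_comm (z : E) u,
      inner_orthogonal_eq_zero, Submodule.coe_inner, real_inner_comm]
    simp [mul_comm]
  rw [h2]
  exact hgN x

variable [FiniteDimensional ℝ E] [MeasurableSpace E] [BorelSpace E]

/-- The volume of the projection of the dual ball to the hyperplane orthogonal to `u`. -/
noncomputable def projVol (N : E → ℝ) (u : E) : ℝ≥0∞ :=
  stdVol (ℝ ∙ u)ᗮ (dualBall (fun y : (ℝ ∙ u)ᗮ => N y))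

lemma projVol_mono {N M : E → ℝ} (h : ∀ x, N x ≤ M x) (u : E) : projVol N u ≤ projVol M u :=
  measure_mono (dualBall_mono fun y => h y)

namespace IsNormFn

variable {N : E → ℝ} (hN : IsNormFn N)

include hN

lemma projVol_ne_top (u : E) : projVol N u ≠ ∞ := (hN.restrict _).stdVol_dualBall_ne_top

/-- Adding a segment in direction `u` increases the volume by its length times the volume of
the projection. -/
lemma stdVol_add_projVol_le {u : E} (hu : ‖u‖ = 1) {r : ℝ} (hr : 0 ≤ r) :
    stdVol E (dualBall N) + ENNReal.ofReal (2 * r) * projVol N u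
      ≤ stdVol E (dualBall fun x => N x + r * |⟪x, u⟫|) := by
  have hD : MeasurableSet (dualBall fun y : (ℝ ∙ u)ᗮ => N y) := isClosed_dualBall.measurableSet
  rw [stdVol_hyperplane hu isClosed_dualBall.measurableSet,
    stdVol_hyperplane hu isClosed_dualBall.measurableSet, projVol, ← setLIntegral_const,
    ← lintegral_indicator hD, ← lintegral_add_right _ (measurable_const.indicator hD)]
  refine lintegral_mono fun y => ?_
  have hc : IsClosed {t : ℝ | (y : E) + t • u ∈ dualBall N} :=
    isClosed_dualBall.preimage (by fun_prop)
  by_cases hy : y ∈ dualBall fun y : (ℝ ∙ u)ᗮ => N y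
  · simp only [Set.indicator_of_mem hy]
    have e : ENNReal.ofReal (2 * r) = volume (Set.Icc (-r) r) := by
      rw [Real.volume_Icc]; ring_nf
    rw [e]
    -- Over a point of the projection the new fibre contains the old fibre plus [-r, r].
    refine (volume_add_volume_le hc.measurableSet measurableSet_Icc
      (hN.exists_add_smul_mem_dualBall hu hy) ⟨0, by simpa using hr⟩).trans (measure_mono ?_)
    rintro _ ⟨t, ht, s, hs, rfl⟩ x
    have h1 := ht x
    have h2 : s * ⟪x, u⟫ ≤ r * |⟪x, u⟫| := by
      refine (le_abs_self _).trans ?_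
      rw [abs_mul]
      gcongr
      exact abs_le.2 hs
    have e2 : (y : E) + (t + s) • u = (y + t • u) + s • u := by module
    change ⟪x, (y : E) + (t + s) • u⟫ ≤ _
    rw [e2, inner_add_right, real_inner_smul_right]
    linarith
  · have : {t : ℝ | (y : E) + t • u ∈ dualBall N} = ∅ := by
      ext t
      simp only [Set.mem_ofPred_eq, Set.mem_empty_iff_false, iff_false]
      exact fun h => hy (mem_dualBall_restrict h)
    simp [this, Set.indicator_of_notMem hy]

/-- Segments are added one at a time. The projections of the intermediate bodies only grow, so those
of the original body serve as lower bounds. -/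
lemma stdVol_add_sum_projVol_le {ι : Type*} (s : Finset ι) {c : ι → ℝ} {u : ι → E}
    (hc : ∀ i, 0 ≤ c i) (hu : ∀ i, ‖u i‖ = 1) {τ : ℝ} (hτ : 0 ≤ τ) :
    IsNormFn (fun x => N x + τ * ∑ i ∈ s, c i * |⟪x, u i⟫|) ∧
    stdVol E (dualBall N) + ∑ i ∈ s, ENNReal.ofReal (2 * (τ * c i)) * projVol N (u i)
      ≤ stdVol E (dualBall fun x => N x + τ * ∑ i ∈ s, c i * |⟪x, u i⟫|) := by
  classical
  induction s using Finset.induction_on with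
  | empty => simpa using hN
  | insert i s hi ih =>
    have e : (fun x => N x + τ * ∑ j ∈ insert i s, c j * |⟪x, u j⟫|)
        = fun x => (N x + τ * ∑ j ∈ s, c j * |⟪x, u j⟫|) + (τ * c i) * |⟪x, u i⟫| := by
      ext x; rw [Finset.sum_insert hi]; ring
    have hτc : 0 ≤ τ * c i := mul_nonneg hτ (hc i)
    rw [e]
    refine ⟨ih.1.add_abs_inner hτc _, le_trans ?_ (ih.1.stdVol_add_projVol_le (hu i) hτc)⟩
    rw [Finset.sum_insert hi, ← add_assoc, add_right_comm]
    gcongr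
    · exact ih.2
    · exact projVol_mono (fun x => le_add_of_nonneg_right
        (mul_nonneg hτ (Finset.sum_nonneg fun j _ => mul_nonneg (hc j) (abs_nonneg _)))) _

/-- If a zonotope is contained in `b` times a body, then the corresponding mean of projection
volumes of the body is at most `b` times its volume. -/
lemma two_mul_sum_projVol_le {ι : Type*} [Fintype ι] {c : ι → ℝ} {u : ι → E}
    (hc : ∀ i, 0 ≤ c i) (hu : ∀ i, ‖u i‖ = 1) {b : ℝ} (hb : 0 < b)
    (h : ∀ x, ∑ i, c i * |⟪x, u i⟫| ≤ b * N x) :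
    2 * ∑ i, c i * (projVol N (u i)).toReal
      ≤ Module.finrank ℝ E * b * (stdVol E (dualBall N)).toReal := by
  set n := Module.finrank ℝ E
  set V := (stdVol E (dualBall N)).toReal with hV
  -- Adding τ times the zonotope keeps the body inside its dilate by 1 + τb; compare volumes, divide
  -- by τ and let τ tend to 0.
  have key : ∀ τ : ℝ, 0 < τ → 2 * ∑ i, c i * (projVol N (u i)).toReal
      ≤ n * b * (1 + τ * b) ^ n * V := by
    intro τ hτ
    have h1 := (hN.stdVol_add_sum_projVol_le Finset.univ hc hu hτ.le).2
    have h2 : stdVol E (dualBall fun x => N x + τ * ∑ i, c i * |⟪x, u i⟫|)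
        ≤ ENNReal.ofReal ((1 + τ * b) ^ n) * stdVol E (dualBall N) := by
      rw [← stdVol_smul_of_pos (by positivity), ← dualBall_const_mul (by positivity)]
      refine measure_mono (dualBall_mono fun x => ?_)
      have := mul_le_mul_of_nonneg_left (h x) hτ.le
      linarith
    have h3 := ENNReal.toReal_mono (ENNReal.mul_ne_top ENNReal.ofReal_ne_top
      hN.stdVol_dualBall_ne_top) (h1.trans h2)
    have hfin : ∀ i ∈ Finset.univ, ENNReal.ofReal (2 * (τ * c i)) * projVol N (u i) ≠ ∞ :=
      fun i _ => ENNReal.mul_ne_top ENNReal.ofReal_ne_top (hN.projVol_ne_top _)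
    rw [ENNReal.toReal_add hN.stdVol_dualBall_ne_top (ENNReal.sum_ne_top.2 hfin),
      ENNReal.toReal_sum hfin, ENNReal.toReal_mul, ENNReal.toReal_ofReal (by positivity), ← hV]
      at h3
    have e : ∑ i, (ENNReal.ofReal (2 * (τ * c i)) * projVol N (u i)).toReal
        = τ * (2 * ∑ i, c i * (projVol N (u i)).toReal) := by
      rw [Finset.mul_sum, Finset.mul_sum]
      refine Finset.sum_congr rfl fun i _ => ?_
      rw [ENNReal.toReal_mul, ENNReal.toReal_ofReal (by have := hc i; positivity)]
      ring
    rw [e] at h3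
    -- Bernoulli for the reciprocal of 1 + τb gives an upper bound on the power.
    have h4 : (1 + τ * b) ^ n - 1 ≤ n * (τ * b) * (1 + τ * b) ^ n := by
      have hx : 0 < 1 + τ * b := by positivity
      have hb1 : -2 ≤ -(τ * b) / (1 + τ * b) := by
        rw [le_div_iff₀ hx]; nlinarith [mul_pos hτ hb]
      have := one_add_mul_le_pow hb1 n
      have e1 : 1 + -(τ * b) / (1 + τ * b) = (1 + τ * b)⁻¹ := by field_simp; ring
      rw [e1, inv_pow] at this
      have h5 : (τ * b) / (1 + τ * b) ≤ τ * b :=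
        div_le_self (by positivity) (by nlinarith [mul_pos hτ hb])
      have h6 : 1 - n * (τ * b) ≤ ((1 + τ * b) ^ n)⁻¹ := by
        refine le_trans ?_ this
        rw [neg_div, mul_neg, sub_eq_add_neg]
        gcongr
      have h7 := mul_le_mul_of_nonneg_right h6 (by positivity : 0 ≤ (1 + τ * b) ^ n)
      rw [inv_mul_cancel₀ (by positivity)] at h7
      linarith
    have hV0 : 0 ≤ V := ENNReal.toReal_nonneg
    refine le_of_mul_le_mul_left ?_ hτ
    nlinarith [mul_le_mul_of_nonneg_right h4 hV0]
  have hlim : Tendsto (fun τ : ℝ => n * b * (1 + τ * b) ^ n * V) (𝓝[>] 0)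
      (𝓝 (n * b * (1 + 0 * b) ^ n * V)) :=
    (Continuous.tendsto (by fun_prop) 0).mono_left nhdsWithin_le_nhds
  simpa using ge_of_tendsto hlim (by filter_upwards [self_mem_nhdsWithin] with τ hτ using key τ hτ)

/-- Integrate the hypothesis against exp(-N) and use `finrank_mul_expInt_le`. -/
lemma le_sum_expMoment {ι : Type*} [Fintype ι] {c : ι → ℝ} {u : ι → E}
    (hc : ∀ i, 0 ≤ c i) {b : ℝ} (hb : 0 ≤ b)
    (h : ∀ x, b * N x ≤ ∑ i, c i * |⟪x, u i⟫|) :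
    Module.finrank ℝ E * b * (expInt N).toReal ≤ ∑ i, c i * (expMoment N (u i)).toReal := by
  have hm := hN.measurable
  have h1 : ENNReal.ofReal b * (Module.finrank ℝ E * expInt N)
      ≤ ∑ i, ENNReal.ofReal (c i) * expMoment N (u i) := by
    refine (mul_le_mul_right hN.finrank_mul_expInt_le _).trans ?_
    simp_rw [expMoment, ← lintegral_const_mul' _ _ ENNReal.ofReal_ne_top]
    rw [← lintegral_finsetSum _ (fun i _ => by fun_prop)]
    refine lintegral_mono fun x => ?_
    simp_rw [fun i => (ENNReal.ofReal_mul (hc i) (q := |⟪x, u i⟫| * Real.exp (-N x))).symm]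
    rw [← ENNReal.ofReal_mul hb]
    rw [← ENNReal.ofReal_sum_of_nonneg
      (fun i _ => mul_nonneg (hc i) (by positivity))]
    refine ENNReal.ofReal_le_ofReal ?_
    simp_rw [← mul_assoc]
    rw [← Finset.sum_mul]
    gcongr
    exact h x
  have hfin : ∀ i ∈ Finset.univ, ENNReal.ofReal (c i) * expMoment N (u i) ≠ ∞ :=
    fun i _ => ENNReal.mul_ne_top ENNReal.ofReal_ne_top (hN.expMoment_ne_top _)
  have h2 := ENNReal.toReal_mono (ENNReal.sum_ne_top.2 hfin) h1
  rw [ENNReal.toReal_sum hfin] at h2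
  simp only [ENNReal.toReal_mul, ENNReal.toReal_ofReal hb, ENNReal.toReal_natCast,
    ENNReal.toReal_ofReal (hc _)] at h2
  linarith

end IsNormFn

end Projection

/-! ### Zonoids: choosing a good direction and the recursive inequality -/

section Zonoidal

variable {E : Type*} [NormedAddCommGroup E] [InnerProductSpace ℝ E]

/-- `N` is approximated by support functions of centred zonotopes. -/
def IsZonoidal (N : E → ℝ) : Prop :=
  ∀ ε > 0, ∃ (m : ℕ) (w : Fin m → E), ∀ x, |∑ i, |⟪x, w i⟫| - N x| ≤ ε * N x

/-- Projections of zonoids are zonoids: on F each w may be replaced by its projection. This is what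
permits induction on the dimension. -/
lemma IsZonoidal.restrict [FiniteDimensional ℝ E] {N : E → ℝ} (h : IsZonoidal N)
    (F : Submodule ℝ E) : IsZonoidal (fun y : F => N y) := by
  intro ε hε
  obtain ⟨m, w, hw⟩ := h ε hε
  refine ⟨m, fun i => F.orthogonalProjectionOnto (w i), fun x => ?_⟩
  simpa using hw x

/-- Zero vectors are dropped so that all weights are strictly positive, as the averaging argument
needs. -/
lemma IsZonoidal.exists_unit {N : E → ℝ} (h : IsZonoidal N) {ε : ℝ} (hε : 0 < ε) :
    ∃ (ι : Type) (_ : Fintype ι) (c : ι → ℝ) (u : ι → E), (∀ i, 0 < c i) ∧ (∀ i, ‖u i‖ = 1) ∧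
      ∀ x, |∑ i, c i * |⟪x, u i⟫| - N x| ≤ ε * N x := by
  classical
  obtain ⟨m, w, hw⟩ := h ε hε
  refine ⟨{i // w i ≠ 0}, inferInstance, fun i => ‖w i‖, fun i => ‖w i‖⁻¹ • w i,
    fun i => norm_pos_iff.2 i.2, fun i => norm_smul_inv_norm (𝕜 := ℝ) i.2, fun x => ?_⟩
  convert hw x using 3
  have e : ∀ i : {i // w i ≠ 0}, ‖w i‖ * |⟪x, ‖w i‖⁻¹ • w i⟫| = |⟪x, w i⟫| := by
    intro i
    have := norm_pos_iff.2 i.2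
    rw [real_inner_smul_right, abs_mul, abs_of_pos (inv_pos.2 this), mul_inv_cancel_left₀ this.ne']
  simp_rw [e]
  rw [← Finset.sum_filter_of_ne (s := Finset.univ) (p := fun i => w i ≠ 0)
    (f := fun i => |⟪x, w i⟫|)]
  · exact (Finset.sum_subtype (p := fun i => w i ≠ 0) _ (by simp) (fun i => |⟪x, w i⟫|)).symm
  · intro i _ hi h0
    simp [h0] at hi

variable [FiniteDimensional ℝ E] [MeasurableSpace E] [BorelSpace E]

/-- The cylinder of height one over the projection of the dual ball. -/
def projCylinder (N : E → ℝ) (u : E) : Set E :=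
  {z | (∀ x, ⟪x, u⟫ = 0 → ⟪x, z⟫ ≤ N x) ∧ |⟪z, u⟫| ≤ 1 / 2}

omit [FiniteDimensional ℝ E] [MeasurableSpace E] [BorelSpace E] in
lemma isClosed_projCylinder (N : E → ℝ) (u : E) : IsClosed (projCylinder N u) := by
  have : projCylinder N u = (⋂ x, ⋂ (_ : ⟪x, u⟫ = 0), {z | ⟪x, z⟫ ≤ N x}) ∩
      {z | |⟪z, u⟫| ≤ 1 / 2} := by
    ext; simp [projCylinder]
  rw [this]
  exact (isClosed_iInter fun x => isClosed_iInter fun _ =>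
    isClosed_le (by fun_prop) continuous_const).inter (isClosed_le (by fun_prop) continuous_const)

omit [FiniteDimensional ℝ E] [MeasurableSpace E] [BorelSpace E] in
lemma add_smul_mem_projCylinder {N : E → ℝ} {u : E} (hu : ‖u‖ = 1) (y : (ℝ ∙ u)ᗮ) (t : ℝ) :
    (y : E) + t • u ∈ projCylinder N u ↔
      y ∈ dualBall (fun y : (ℝ ∙ u)ᗮ => N y) ∧ |t| ≤ 1 / 2 := by
  rw [projCylinder, Set.mem_ofPred_eq, inner_hyperplane hu]
  refine and_congr_left fun _ => ⟨fun h x => ?_, fun h x hx => ?_⟩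
  · have := h x (inner_orthogonal_eq_zero x)
    rwa [inner_add_right, real_inner_smul_right, inner_orthogonal_eq_zero, mul_zero, add_zero]
      at this
  · have hx' : x ∈ (ℝ ∙ u)ᗮ := by
      rw [Submodule.mem_orthogonal_singleton_iff_inner_right, real_inner_comm]; exact hx
    rw [inner_add_right, real_inner_smul_right, hx, mul_zero, add_zero]
    exact h ⟨x, hx'⟩

/-- Projections in different directions live in different hyperplanes; the cylinders put their
volumes into the common space E. -/
lemma stdVol_projCylinder (N : E → ℝ) {u : E} (hu : ‖u‖ = 1) :
    stdVol E (projCylinder N u) = projVol N u := by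
  rw [stdVol_hyperplane hu (isClosed_projCylinder N u).measurableSet, projVol,
    ← setLIntegral_one, ← lintegral_indicator IsNormFn.isClosed_dualBall.measurableSet]
  refine lintegral_congr fun y => ?_
  simp_rw [add_smul_mem_projCylinder hu]
  by_cases hy : y ∈ dualBall fun y : (ℝ ∙ u)ᗮ => N y
  · have : {t : ℝ | |t| ≤ 1 / 2} = Set.Icc (-(1 / 2)) (1 / 2) := by ext; simp [abs_le]
    simp only [hy, true_and, Set.indicator_of_mem, this, Real.volume_Icc]
    norm_num
  · simp [hy]

namespace IsNormFn

variable {N : E → ℝ} (hN : IsNormFn N)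

include hN

/-- Continuity in the direction: the cylinder for u lies in the dilate by 1 + K‖u - v‖ of the
cylinder for v. -/
lemma exists_projVol_le : ∃ K ≥ 0, ∀ u v : E, ‖u‖ = 1 → ‖v‖ = 1 →
    projVol N u ≤ ENNReal.ofReal ((1 + K * ‖u - v‖) ^ Module.finrank ℝ E) * projVol N v := by
  obtain ⟨c, hc, hlow⟩ := hN.exists_lower
  obtain ⟨C, hC, hup⟩ := hN.exists_upper
  -- The first summand pays for testing against vectors orthogonal to v instead of u, the second for
  -- the change in height.
  refine ⟨(C + 1) / c + 2 * (C + 1), by positivity, fun u v hu hv => ?_⟩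
  set η := ‖u - v‖ with hη
  set K := (C + 1) / c + 2 * (C + 1) with hK
  have hη0 : 0 ≤ η := norm_nonneg _
  have hpos : 0 < 1 + K * η := by positivity
  rw [← stdVol_projCylinder N hu, ← stdVol_projCylinder N hv, ← stdVol_smul_of_pos hpos]
  refine measure_mono fun z hz => ?_
  rw [Set.mem_smul_set_iff_inv_smul_mem₀ hpos.ne']
  have hzn : ‖z‖ ≤ C + 1 := by
    obtain ⟨y, hy⟩ := exists_eq_add_inner_smul hu z
    have hy2 := hz.1 y (inner_orthogonal_eq_zero y)
    have hyz : ⟪(y : E), z⟫ = ‖(y : E)‖ ^ 2 := by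
      rw [hy, inner_add_right, real_inner_smul_right, inner_orthogonal_eq_zero,
        real_inner_self_eq_norm_sq]; ring
    rw [hyz] at hy2
    have hyC : ‖(y : E)‖ ≤ C := by
      by_contra hlt
      push Not at hlt
      have := hup y
      nlinarith
    have h2 := hz.2
    calc ‖z‖ ≤ ‖(y : E)‖ + ‖⟪z, u⟫ • u‖ := by
          conv_lhs => rw [hy]
          exact norm_add_le _ _
      _ ≤ C + 1 := by
          rw [norm_smul, hu, mul_one, Real.norm_eq_abs]; linarith
  refine ⟨fun x hx => ?_, ?_⟩
  · rw [real_inner_smul_right, inv_mul_le_iff₀ hpos]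
    obtain ⟨y, hy⟩ := exists_eq_add_inner_smul hu x
    have hxu : |⟪x, u⟫| ≤ ‖x‖ * η := by
      have : ⟪x, u⟫ = ⟪x, u - v⟫ := by rw [inner_sub_right, hx, sub_zero]
      rw [this]; exact abs_real_inner_le_norm _ _
    have h1 : ⟪x, z⟫ ≤ N y + ‖x‖ * η := by
      have h2 := hz.1 y (inner_orthogonal_eq_zero y)
      have h3 := hz.2
      have e : ⟪x, z⟫ = ⟪(y : E), z⟫ + ⟪x, u⟫ * ⟪z, u⟫ := by
        conv_lhs => rw [hy]
        rw [inner_add_left, real_inner_smul_left, real_inner_comm u z]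
      have h4 : ⟪x, u⟫ * ⟪z, u⟫ ≤ ‖x‖ * η := by
        refine (le_abs_self _).trans ?_
        rw [abs_mul]
        calc |⟪x, u⟫| * |⟪z, u⟫| ≤ (‖x‖ * η) * 1 := by
              gcongr; linarith
          _ = _ := mul_one _
      linarith
    have h2 : N y ≤ N x + C * (‖x‖ * η) := by
      have h3 := hN.le_add_sub y x
      have e : (y : E) - x = -(⟪x, u⟫ • u) := by
        conv_lhs => rw [hy]
        abel
      rw [e, hN.map_neg, hN.smul] at h3
      have h4 := hup u
      rw [hu, mul_one] at h4
      have : |⟪x, u⟫| * N u ≤ (‖x‖ * η) * C := by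
        have := hN.nonneg u
        gcongr
      linarith
    have h3 : ‖x‖ ≤ N x / c := by
      rw [le_div_iff₀ hc, mul_comm]; exact hlow x
    have h4 : (C + 1) * (‖x‖ * η) ≤ (C + 1) * (N x / c * η) := by gcongr
    have h5 : (C + 1) * (N x / c * η) ≤ K * η * N x := by
      have : (C + 1) * (N x / c * η) = (C + 1) / c * η * N x := by ring
      rw [this, hK]
      have := hN.nonneg x
      gcongr
      linarith
    linarith
  · rw [real_inner_smul_left, abs_mul, abs_of_pos (inv_pos.2 hpos), inv_mul_le_iff₀ hpos]
    have h1 : |⟪z, v⟫| ≤ |⟪z, u⟫| + (C + 1) * η := by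
      have e : ⟪z, v⟫ = ⟪z, u⟫ - ⟪z, u - v⟫ := by rw [inner_sub_right]; ring
      rw [e]
      refine (abs_sub _ _).trans (add_le_add_right ?_ _)
      exact (abs_real_inner_le_norm _ _).trans (by gcongr)
    have h2 := hz.2
    have h3 : 2 * (C + 1) * η ≤ K * η := by
      rw [hK]
      gcongr
      have : 0 ≤ (C + 1) / c := by positivity
      linarith
    linarith

/-- If the inequality failed for every unit vector, its sum with weights c would contradict
`two_mul_sum_projVol_le` combined with `le_sum_expMoment`. -/
lemma exists_projVol_mul_le_of_pos (hZ : IsZonoidal N) (hn : 0 < Module.finrank ℝ E) {ε : ℝ}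
    (hε : 0 < ε) (hε1 : ε < 1) : ∃ u : E, ‖u‖ = 1 ∧
    2 * (projVol N u).toReal * (expInt N).toReal * (1 - ε)
      ≤ (1 + ε) * (expMoment N u).toReal * (stdVol E (dualBall N)).toReal := by
  obtain ⟨ι, _, c, u, hc, hu, h⟩ := hZ.exists_unit hε
  have h1 := hN.two_mul_sum_projVol_le (fun i => (hc i).le) hu (b := 1 + ε) (by positivity)
    (fun x => by have := (abs_le.1 (h x)).2; linarith)
  have h2 := hN.le_sum_expMoment (fun i => (hc i).le) (u := u) (b := 1 - ε) (by linarith)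
    (fun x => by have := (abs_le.1 (h x)).1; linarith)
  set n : ℝ := (Module.finrank ℝ E : ℝ) with hn'
  have hn0 : 0 < n := by rw [hn']; exact_mod_cast hn
  set I := (expInt N).toReal with hI
  set V := (stdVol E (dualBall N)).toReal with hV
  have hI0 : 0 < I := ENNReal.toReal_pos hN.expInt_ne_zero hN.expInt_ne_top
  have hV0 : 0 < V := ENNReal.toReal_pos hN.stdVol_dualBall_ne_zero hN.stdVol_dualBall_ne_top
  by_contra hcon
  push Not at hcon
  have hne : (Finset.univ : Finset ι).Nonempty := by
    by_contra hemp
    rw [Finset.not_nonempty_iff_eq_empty] at hemp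
    rw [hemp, Finset.sum_empty] at h2
    have : 0 < n * (1 - ε) * I := by
      have : 0 < 1 - ε := by linarith
      positivity
    linarith
  have h3 : ∑ i, c i * ((1 + ε) * (expMoment N (u i)).toReal * V)
      < ∑ i, c i * (2 * (projVol N (u i)).toReal * I * (1 - ε)) :=
    Finset.sum_lt_sum_of_nonempty hne fun i _ => mul_lt_mul_of_pos_left (hcon _ (hu i)) (hc i)
  have e1 : ∑ i, c i * ((1 + ε) * (expMoment N (u i)).toReal * V)
      = (1 + ε) * V * ∑ i, c i * (expMoment N (u i)).toReal := by
    rw [Finset.mul_sum]; exact Finset.sum_congr rfl fun i _ => by ring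
  have e2 : ∑ i, c i * (2 * (projVol N (u i)).toReal * I * (1 - ε))
      = I * (1 - ε) * (2 * ∑ i, c i * (projVol N (u i)).toReal) := by
    rw [Finset.mul_sum, Finset.mul_sum]; exact Finset.sum_congr rfl fun i _ => by ring
  rw [e1, e2] at h3
  have h4 := mul_le_mul_of_nonneg_left h2 (by positivity : 0 ≤ (1 + ε) * V)
  have h5 := mul_le_mul_of_nonneg_left h1 (mul_nonneg hI0.le (by linarith) : 0 ≤ I * (1 - ε))
  linarith

/-- Some projection volume is controlled by the first moment in the same direction. -/
lemma exists_projVol_mul_le (hZ : IsZonoidal N) (hn : 0 < Module.finrank ℝ E) :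
    ∃ u : E, ‖u‖ = 1 ∧ 2 * projVol N u * expInt N ≤ expMoment N u * stdVol E (dualBall N) := by
  set I := (expInt N).toReal with hI
  set V := (stdVol E (dualBall N)).toReal with hV
  set n := Module.finrank ℝ E
  obtain ⟨K, hK, hKle⟩ := hN.exists_projVol_le
  set B := (∫⁻ x, ENNReal.ofReal (‖x‖ * Real.exp (-N x)) ∂stdVol E).toReal
  -- The shift by 2 keeps ε below 1 already at k = 0.
  let ε : ℕ → ℝ := fun k => 1 / ((k : ℝ) + 2)
  have hε : ∀ k, 0 < ε k := fun k => by positivity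
  have hε1 : ∀ k, ε k < 1 := fun k => by
    simp only [ε]
    rw [div_lt_one (by positivity)]
    have : (0 : ℝ) ≤ k := by positivity
    linarith
  have hεlim : Tendsto ε atTop (𝓝 0) := by
    have := (tendsto_const_div_atTop_nhds_zero_nat (1 : ℝ)).comp (tendsto_add_atTop_nat 2)
    refine this.congr fun k => ?_
    simp [ε]
  choose v hv1 hv2 using fun k => hN.exists_projVol_mul_le_of_pos hZ hn (hε k) (hε1 k)
  obtain ⟨u, hu, θ, hθ, hlim⟩ := (isCompact_sphere (0 : E) 1).tendsto_subseq
    (x := v) (fun k => by simpa using hv1 k)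
  have hu : ‖u‖ = 1 := by simpa using hu
  have hη : Tendsto (fun k => ‖u - v (θ k)‖) atTop (𝓝 0) := by
    have := (tendsto_const_nhds (x := u)).sub hlim
    simpa using this.norm
  have hε' := hεlim.comp hθ.tendsto_atTop
  -- Moving from the approximating direction to the limit u costs only errors that vanish with their
  -- distance.
  have key : ∀ k, 2 * (projVol N u).toReal * I * (1 - ε (θ k)) ≤
      (1 + K * ‖u - v (θ k)‖) ^ n *
        ((1 + ε (θ k)) * ((expMoment N u).toReal + ‖u - v (θ k)‖ * B) * V) := by
    intro k
    set w := v (θ k)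
    have h1 := ENNReal.toReal_mono (ENNReal.mul_ne_top ENNReal.ofReal_ne_top (hN.projVol_ne_top _))
      (hKle u w hu (hv1 _))
    rw [ENNReal.toReal_mul, ENNReal.toReal_ofReal (by positivity)] at h1
    have h2 := ENNReal.toReal_mono (ENNReal.add_ne_top.2 ⟨hN.expMoment_ne_top _,
      ENNReal.mul_ne_top ENNReal.ofReal_ne_top hN.lintegral_norm_mul_exp_ne_top⟩)
      (hN.expMoment_le_add u w)
    rw [ENNReal.toReal_add (hN.expMoment_ne_top _)
      (ENNReal.mul_ne_top ENNReal.ofReal_ne_top hN.lintegral_norm_mul_exp_ne_top),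
      ENNReal.toReal_mul, ENNReal.toReal_ofReal (by positivity), norm_sub_rev] at h2
    have hI0 : 0 ≤ I := ENNReal.toReal_nonneg
    have hV0 : 0 ≤ V := ENNReal.toReal_nonneg
    have he := hε (θ k)
    have he1 := hε1 (θ k)
    have he2 : 0 ≤ 1 - ε (θ k) := by linarith
    calc 2 * (projVol N u).toReal * I * (1 - ε (θ k))
        ≤ 2 * ((1 + K * ‖u - w‖) ^ n * (projVol N w).toReal) * I * (1 - ε (θ k)) := by gcongr
      _ = (1 + K * ‖u - w‖) ^ n * (2 * (projVol N w).toReal * I * (1 - ε (θ k))) := by ring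
      _ ≤ (1 + K * ‖u - w‖) ^ n * ((1 + ε (θ k)) * (expMoment N w).toReal * V) := by
          exact mul_le_mul_of_nonneg_left (hv2 _) (by positivity)
      _ ≤ _ := by gcongr
  have hl1 : Tendsto (fun k => 2 * (projVol N u).toReal * I * (1 - ε (θ k))) atTop
      (𝓝 (2 * (projVol N u).toReal * I * (1 - 0))) :=
    (tendsto_const_nhds.sub hε').const_mul _
  have hl2 : Tendsto (fun k => (1 + K * ‖u - v (θ k)‖) ^ n *
        ((1 + ε (θ k)) * ((expMoment N u).toReal + ‖u - v (θ k)‖ * B) * V)) atTop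
      (𝓝 ((1 + K * 0) ^ n * ((1 + 0) * ((expMoment N u).toReal + 0 * B) * V))) :=
    (((hη.const_mul K).const_add 1).pow n).mul
      (((hε'.const_add 1).mul ((hη.mul_const B).const_add _)).mul_const V)
  have hfin := le_of_tendsto_of_tendsto' hl1 hl2 key
  refine ⟨u, hu, ?_⟩
  rw [← ENNReal.toReal_le_toReal]
  · simpa using hfin
  · exact ENNReal.mul_ne_top (ENNReal.mul_ne_top (by simp) (hN.projVol_ne_top u)) hN.expInt_ne_top
  · exact ENNReal.mul_ne_top (hN.expMoment_ne_top u) hN.stdVol_dualBall_ne_top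

/-- The recursive inequality for the volume product, with its equality condition. -/
lemma exists_four_mul_le (hZ : IsZonoidal N) (hn : 0 < Module.finrank ℝ E) :
    ∃ u : E, ‖u‖ = 1 ∧
      4 * (projVol N u * expSlice N u 0) ≤ stdVol E (dualBall N) * expInt N ∧
      (stdVol E (dualBall N) * expInt N ≤ 4 * (projVol N u * expSlice N u 0) →
        2 * (expSlice N u 0 * expMoment N u) = expInt N ^ 2) := by
  obtain ⟨u, hu, h⟩ := hN.exists_projVol_mul_le hZ hn
  have hm := hN.two_mul_expSlice_zero_mul_expMoment_le hu
  have hI0 := hN.expInt_ne_zero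
  have hIt := hN.expInt_ne_top
  have hV0 := hN.stdVol_dualBall_ne_zero
  have hVt := hN.stdVol_dualBall_ne_top
  set I := expInt N
  set V := stdVol E (dualBall N)
  -- Both claims come from this bound: the moment inequality caps its right side by V I², and
  -- equality at the ends forces equality there.
  have h1 : 4 * (projVol N u * expSlice N u 0) * I ≤ V * (2 * (expSlice N u 0 * expMoment N u)) :=
    calc _ = (2 * projVol N u * I) * (2 * expSlice N u 0) := by ring
      _ ≤ (expMoment N u * V) * (2 * expSlice N u 0) := by gcongr
      _ = _ := by ring
  refine ⟨u, hu, ?_, fun h2 => le_antisymm hm ?_⟩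
  · rw [← ENNReal.mul_le_mul_iff_left hI0 hIt]
    calc _ ≤ _ := h1
      _ ≤ V * I ^ 2 := by gcongr
      _ = _ := by ring
  · rw [← ENNReal.mul_le_mul_iff_right hV0 hVt]
    calc V * I ^ 2 = V * I * I := by ring
      _ ≤ _ := mul_le_mul_left h2 _
      _ ≤ _ := h1

end IsNormFn

end Zonoidal

/-! ### Equality in the moment inequality forces a double cone -/

lemma le_one_of_pow_le {q C : ℝ} (h : ∀ k : ℕ, q ^ (k + 1) ≤ C) : q ≤ 1 := by
  by_contra hq
  push Not at hq
  obtain ⟨k, hk⟩ := ((tendsto_pow_atTop_atTop_of_one_lt hq).eventually_gt_atTop C).exists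
  have h1 := h k
  have h2 : q ^ k ≤ q ^ (k + 1) := pow_le_pow_right₀ hq.le (Nat.le_succ k)
  linarith

section Equality

variable {E : Type*} [NormedAddCommGroup E] [InnerProductSpace ℝ E]
  [FiniteDimensional ℝ E] [MeasurableSpace E] [BorelSpace E]

namespace IsNormFn

variable {N : E → ℝ} (hN : IsNormFn N)

include hN

omit [MeasurableSpace E] [BorelSpace E] in
-- The point e maximises the height over the unit ball of N; it is the future apex of the double
-- cone.
lemma exists_apex {u : E} (hu : ‖u‖ = 1) :
    ∃ e : E, N e ≤ 1 ∧ 0 < ⟪e, u⟫ ∧ ∀ x, |⟪x, u⟫| ≤ ⟪e, u⟫ * N x := by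
  obtain ⟨c, hc, hlow⟩ := hN.exists_lower
  have hcomp : IsCompact {x | N x ≤ 1} := by
    refine (isCompact_closedBall (0 : E) c⁻¹).of_isClosed_subset
      (isClosed_le hN.continuous continuous_const) fun x hx => ?_
    rw [mem_closedBall_zero_iff, ← one_div, le_div_iff₀ hc, mul_comm]
    exact (hlow x).trans hx
  obtain ⟨e, he, hmax⟩ := hcomp.exists_isMaxOn ⟨0, by simp [hN.map_zero]⟩
    (f := fun x => ⟪x, u⟫) (by fun_prop)
  have h1 : ∀ x, ⟪x, u⟫ ≤ ⟪e, u⟫ * N x := by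
    intro x
    by_cases hx : N x = 0
    · rw [hN.eq_zero hx]; simp [hN.map_zero]
    · have hpos : 0 < N x := lt_of_le_of_ne (hN.nonneg x) (Ne.symm hx)
      have : ⟪(N x)⁻¹ • x, u⟫ ≤ ⟪e, u⟫ := hmax (a := (N x)⁻¹ • x) (by
        simp [hN.smul, abs_of_pos hpos, hx])
      rw [real_inner_smul_left, inv_mul_le_iff₀ hpos] at this
      linarith
  refine ⟨e, he, ?_, fun x => abs_le.2 ⟨?_, h1 x⟩⟩
  · have h2 := h1 u
    rw [real_inner_self_eq_norm_sq, hu] at h2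
    by_contra h0
    push Not at h0
    have := mul_nonpos_of_nonpos_of_nonneg h0 (hN.nonneg u)
    linarith
  · have := h1 (-x)
    rw [inner_neg_left, hN.map_neg] at this
    linarith

/-- Split N as (1 - δ)N + δN: the first part is at least (1 - δ)r/a at height r, the second keeps
integrability. The rate is nearly 1/a, with a prefactor independent of r. -/
lemma expSlice_const_mul_le (u : E) {δ : ℝ} (hδ : 0 < δ) {a : ℝ} (ha : 0 < a)
    (hu : ‖u‖ = 1) (h : ∀ x, |⟪x, u⟫| ≤ a * N x) (hδ1 : δ < 1) {r : ℝ} (hr : 0 ≤ r) :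
    expSlice N u r ≤ ENNReal.ofReal (Real.exp (r * (-1 / a + δ * (1 / a + N u)))) *
      expSlice (fun x => δ * N x) u 0 := by
  rw [expSlice, expSlice, ← lintegral_const_mul' _ _ ENNReal.ofReal_ne_top]
  refine lintegral_mono fun y => ?_
  rw [← ENNReal.ofReal_mul (by positivity), ← Real.exp_add]
  refine ENNReal.ofReal_le_ofReal (Real.exp_le_exp.2 ?_)
  have h1 := h (y + r • u)
  rw [inner_hyperplane hu, abs_of_nonneg hr, ← div_le_iff₀' ha] at h1
  have h2 := hN.le_add_sub (y : E) (y + r • u)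
  have e : (y : E) - (y + r • u) = -(r • u) := by abel
  rw [e, hN.map_neg, hN.smul_of_nonneg hr] at h2
  simp only [zero_smul, add_zero]
  have h3 := mul_le_mul_of_nonneg_left h1 (by linarith : 0 ≤ 1 - δ)
  have h4 := mul_le_mul_of_nonneg_left h2 hδ.le
  have e2 : r * (-1 / a + δ * (1 / a + N u)) = -((1 - δ) * (r / a)) + δ * (r * N u) := by
    ring
  rw [e2]
  nlinarith

/-- In the equality case of the moment inequality the slice function decays at least like the
slice function of a double cone. -/
lemma expSlice_le_of_eq {u : E} (hu : ‖u‖ = 1)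
    (heq : 2 * (expSlice N u 0 * expMoment N u) = expInt N ^ 2) {a : ℝ} (ha : 0 < a)
    (h : ∀ x, |⟪x, u⟫| ≤ a * N x) {r : ℝ} (hr : 0 < r) :
    expSlice N u r ≤ ENNReal.ofReal (Real.exp (-(r / a))) * expSlice N u 0 := by
  set f : ℝ → ℝ := fun t => (expSlice N u t).toReal with hf
  have hf0 : 0 < f 0 := ENNReal.toReal_pos (hN.expSlice_ne_zero u 0) (hN.expSlice_ne_top u 0)
  have hfr : 0 < f r := ENNReal.toReal_pos (hN.expSlice_ne_zero u r) (hN.expSlice_ne_top u r)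
  have hmul : ∀ s t, 0 < s → 0 < t → f 0 * f (s + t) = f s * f t := fun s t hs ht => by
    have := congrArg ENNReal.toReal (hN.expSlice_zero_mul_eq hu heq hs ht)
    simpa using this
  have hpow : ∀ k : ℕ, f ((k + 1) * r) / f 0 = (f r / f 0) ^ (k + 1) := by
    intro k
    induction k with
    | zero => simp
    | succ k ih =>
      have := hmul ((k + 1) * r) r (by positivity) hr
      rw [pow_succ, ← ih]
      have e : ((k + 1 : ℕ) + 1 : ℝ) * r = (k + 1) * r + r := by push_cast; ring
      rw [e]
      rw [div_mul_div_comm, ← this, mul_div_mul_left _ _ hf0.ne']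
  have key : ∀ δ : ℝ, 0 < δ → δ < 1 →
      f r / f 0 ≤ Real.exp (r * (-1 / a + δ * (1 / a + N u))) := by
    intro δ hδ hδ1
    set β := -1 / a + δ * (1 / a + N u)
    have hNδ := hN.const_mul hδ
    -- By multiplicativity the powers of this quotient are values at multiples of r, bounded
    -- uniformly; hence the prefactor disappears.
    have hq : f r / f 0 / Real.exp (r * β) ≤ 1 := by
      refine le_one_of_pow_le (C := (expSlice (fun x => δ * N x) u 0).toReal / f 0) fun k => ?_
      rw [div_pow, ← hpow, ← Real.exp_nat_mul, div_le_iff₀ (Real.exp_pos _), div_mul_eq_mul_div]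
      gcongr
      have := ENNReal.toReal_mono (ENNReal.mul_ne_top ENNReal.ofReal_ne_top
        (hNδ.expSlice_ne_top u 0))
        (hN.expSlice_const_mul_le u hδ ha hu h hδ1 (r := (k + 1) * r) (by positivity))
      rw [ENNReal.toReal_mul, ENNReal.toReal_ofReal (Real.exp_pos _).le, mul_comm (Real.exp _)] at this
      rw [mul_assoc] at this
      push_cast
      exact this
    rwa [div_le_one (Real.exp_pos _)] at hq
  have hlim : Tendsto (fun δ : ℝ => Real.exp (r * (-1 / a + δ * (1 / a + N u)))) (𝓝[>] 0)
      (𝓝 (Real.exp (r * (-1 / a + 0 * (1 / a + N u))))) :=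
    (Continuous.tendsto (by fun_prop) 0).mono_left nhdsWithin_le_nhds
  have hfin := ge_of_tendsto hlim (by
    filter_upwards [Ioo_mem_nhdsGT (zero_lt_one' ℝ)] with δ hδ using key δ hδ.1 hδ.2)
  rw [div_le_iff₀ hf0] at hfin
  rw [← ENNReal.ofReal_toReal (hN.expSlice_ne_top u r),
    ← ENNReal.ofReal_toReal (hN.expSlice_ne_top u 0), ← ENNReal.ofReal_mul (Real.exp_pos _).le]
  refine ENNReal.ofReal_le_ofReal (hfin.trans (le_of_eq ?_))
  congr 2
  ring

/-- In the equality case of the moment inequality, the unit ball of `N` is a double cone. -/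
lemma exists_split_of_eq {u : E} (hu : ‖u‖ = 1)
    (heq : 2 * (expSlice N u 0 * expMoment N u) = expInt N ^ 2) :
    ∃ e : E, 0 < ⟪e, u⟫ ∧ ∀ (y : (ℝ ∙ u)ᗮ) (t : ℝ), N (y + t • e) = N y + |t| := by
  obtain ⟨e, he1, hepos, hmax⟩ := hN.exists_apex hu
  set a := ⟪e, u⟫ with ha
  obtain ⟨e₀, he₀⟩ := exists_eq_add_inner_smul hu e
  rw [← ha] at he₀
  have hcN := hN.continuous
  have hle : ∀ (y : (ℝ ∙ u)ᗮ) (t : ℝ), 0 < t → N (y + t • e) ≤ N y + t := fun y t ht => by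
    refine (hN.add_le _ _).trans ?_
    rw [hN.smul_of_nonneg ht.le]
    nlinarith
  have hpos : ∀ (t : ℝ), 0 < t → ∀ y : (ℝ ∙ u)ᗮ, N (y + t • e) = N y + t := by
    intro t ht
    -- Translating by t times the horizontal part of e places the slice at height ta over the points
    -- y + te.
    have h1 : expSlice N u (t * a) = ∫⁻ y : (ℝ ∙ u)ᗮ,
        ENNReal.ofReal (Real.exp (-N (y + t • e))) ∂stdVol (ℝ ∙ u)ᗮ := by
      rw [expSlice, ← lintegral_add_right_eq_self (μ := stdVol (ℝ ∙ u)ᗮ) _ (t • e₀)]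
      refine lintegral_congr fun y => ?_
      congr 4
      conv_rhs => rw [he₀]
      push_cast
      module
    have h2 : expSlice N u (t * a) ≤ ∫⁻ y : (ℝ ∙ u)ᗮ,
        ENNReal.ofReal (Real.exp (-(N y + t))) ∂stdVol (ℝ ∙ u)ᗮ := by
      refine (hN.expSlice_le_of_eq hu heq hepos hmax (by positivity)).trans (le_of_eq ?_)
      rw [expSlice, ← lintegral_const_mul' _ _ ENNReal.ofReal_ne_top]
      refine lintegral_congr fun y => ?_
      rw [← ENNReal.ofReal_mul (by positivity), ← Real.exp_add, mul_div_cancel_right₀ _ hepos.ne']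
      congr 2
      simp only [zero_smul, add_zero]
      ring
    rw [h1] at h2
    have hc1 : Continuous fun y : (ℝ ∙ u)ᗮ => ENNReal.ofReal (Real.exp (-N (y + t • e))) :=
      ENNReal.continuous_ofReal.comp (by fun_prop)
    have hc2 : Continuous fun y : (ℝ ∙ u)ᗮ => ENNReal.ofReal (Real.exp (-(N y + t))) :=
      ENNReal.continuous_ofReal.comp (by fun_prop)
    -- The triangle inequality with N(e) ≤ 1 orders the integrands one way and the decay bound
    -- orders the integrals the other way.
    have hae := ae_eq_of_ae_le_of_lintegral_le (μ := stdVol (ℝ ∙ u)ᗮ)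
      (f := fun y => ENNReal.ofReal (Real.exp (-(N y + t))))
      (ae_of_all _ fun y => ENNReal.ofReal_le_ofReal
        (Real.exp_le_exp.2 (neg_le_neg (hle y t ht)))) ?_ hc1.measurable.aemeasurable h2
    · intro y
      have := congrFun (Measure.eq_of_ae_eq hae hc2 hc1) y
      rw [ENNReal.ofReal_eq_ofReal_iff (Real.exp_pos _).le (Real.exp_pos _).le] at this
      have := Real.exp_injective this
      linarith
    · refine ((lintegral_mono fun y => ENNReal.ofReal_le_ofReal
        (Real.exp_le_exp.2 (neg_le_neg (hle y t ht)))).trans_lt ?_).ne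
      rw [← h1]
      exact (hN.expSlice_ne_top u _).lt_top
  refine ⟨e, hepos, fun y t => ?_⟩
  rcases lt_trichotomy t 0 with ht | rfl | ht
  · have := hpos (-t) (neg_pos.2 ht) (-y)
    rw [abs_of_neg ht, ← hN.map_neg (y : E), ← hN.map_neg]
    rw [← Submodule.coe_neg, ← this]
    congr 1
    push_cast
    module
  · simp
  · rw [abs_of_pos ht]; exact hpos t ht y

end IsNormFn

end Equality

/-! ### Induction on the dimension -/

/-- Reisner's theorem in terms of support functions, with the equality case. -/
theorem four_pow_le_of_isZonoidal (n : ℕ) : ∀ {E : Type*} [NormedAddCommGroup E]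
    [InnerProductSpace ℝ E] [FiniteDimensional ℝ E] [MeasurableSpace E] [BorelSpace E],
    Module.finrank ℝ E = n → ∀ {N : E → ℝ}, IsNormFn N → IsZonoidal N →
    4 ^ n ≤ stdVol E (dualBall N) * expInt N ∧
    (stdVol E (dualBall N) * expInt N = 4 ^ n →
      ∃ b : Fin n → E, ∀ x, N x = ∑ i, |⟪x, b i⟫|) := by
  induction n with
  | zero =>
    intro E _ _ _ _ _ hE N hN hZ
    have hsub : Subsingleton E := Module.finrank_zero_iff.1 hE
    have h1 : stdVol E Set.univ = 1 := by
      rw [stdVol, ← (stdOrthonormalBasis ℝ E).toBasis.addHaar_self]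
      congr 1
      refine (Set.eq_univ_of_forall fun x => ?_).symm
      have : x = 0 := Subsingleton.elim _ _
      rw [this, parallelepiped]
      exact ⟨0, by simp, by simp⟩
    have h0 : ∀ x, N x = 0 := fun x => by rw [Subsingleton.elim x 0, hN.map_zero]
    refine ⟨?_, fun _ => ⟨Fin.elim0, fun x => by simp [h0]⟩⟩
    have h2 : dualBall N = Set.univ := by
      ext z; simp [dualBall, h0, Subsingleton.elim z 0]
    have h3 : expInt N = 1 := by simp [expInt, h0, h1]
    simp [h1, h2, h3]
  | succ n ih =>
    intro E _ _ _ _ _ hE N hN hZ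
    obtain ⟨u, hu, h1, h2⟩ := hN.exists_four_mul_le hZ (by omega)
    have : Fact (Module.finrank ℝ E = n + 1) := ⟨hE⟩
    have hF : Module.finrank ℝ (ℝ ∙ u)ᗮ = n :=
      Submodule.finrank_orthogonal_span_singleton (by rintro rfl; simp at hu)
    obtain ⟨ih1, ih2⟩ := ih hF (hN.restrict _) (hZ.restrict _)
    rw [IsNormFn.expSlice_zero] at h1 h2
    have h3 : (4 : ℝ≥0∞) ^ (n + 1) ≤
        4 * (projVol N u * expInt fun y : (ℝ ∙ u)ᗮ => N y) := by
      rw [pow_succ']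
      exact mul_le_mul_right ih1 _
    refine ⟨h3.trans h1, fun heq => ?_⟩
    -- Overall equality forces equality both in the recursive inequality and in the induction
    -- hypothesis on the hyperplane.
    have h4 := h2 (heq.le.trans h3)
    rw [heq, pow_succ'] at h1
    have h5 := (ENNReal.mul_le_mul_iff_right (by norm_num) (by norm_num)).1 h1
    obtain ⟨b, hb⟩ := ih2 (le_antisymm h5 ih1)
    rw [← IsNormFn.expSlice_zero] at h4
    obtain ⟨e, he, hsplit⟩ := hN.exists_split_of_eq hu h4
    -- Decompose x along e as (x - te) + te. The first vector reads off t, and the corrected ones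
    -- pair with x as b i pairs with x - te.
    refine ⟨Fin.cons ((⟪e, u⟫)⁻¹ • u) fun i => b i - ((⟪e, u⟫)⁻¹ * ⟪e, (b i : E)⟫) • u,
      fun x => ?_⟩
    set t := (⟪e, u⟫)⁻¹ * ⟪x, u⟫ with ht
    have hy : x - t • e ∈ (ℝ ∙ u)ᗮ := by
      rw [Submodule.mem_orthogonal_singleton_iff_inner_right, real_inner_comm, inner_sub_left,
        real_inner_smul_left, ht]
      field_simp
      ring
    have h6 := hsplit ⟨x - t • e, hy⟩ t
    have h7 := hb ⟨x - t • e, hy⟩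
    simp only [sub_add_cancel] at h6 h7
    rw [h6, h7, Fin.sum_univ_succ, add_comm]
    simp only [Fin.cons_zero, Fin.cons_succ, real_inner_smul_right]
    congr 1
    refine Finset.sum_congr rfl fun i _ => ?_
    rw [Submodule.coe_inner]
    simp only [inner_sub_left, inner_sub_right, real_inner_smul_left, real_inner_smul_right]
    congr 1
    rw [ht]
    ring

/-! ### Support functions, polarity and the volume product -/

section SupportFunction

variable {E : Type*} [NormedAddCommGroup E] [InnerProductSpace ℝ E]

/-- The support function of a set. -/
noncomputable def suppFn (Z : Set E) (x : E) : ℝ := sSup ((fun z => ⟪x, z⟫) '' Z)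

lemma inner_le_suppFn {Z : Set E} (hZ : IsCompact Z) (x : E) {z : E} (hz : z ∈ Z) :
    ⟪x, z⟫ ≤ suppFn Z x :=
  le_csSup (hZ.image (by fun_prop)).bddAbove (Set.mem_image_of_mem _ hz)

lemma exists_suppFn_eq {Z : Set E} (hZ : IsCompact Z) (hne : Z.Nonempty) (x : E) :
    ∃ z ∈ Z, suppFn Z x = ⟪x, z⟫ :=
  hZ.exists_sSup_image_eq hne (f := fun z => ⟪x, z⟫) (by fun_prop)

namespace IsConvexBody

variable {Z : Set E} (hZ : IsConvexBody Z) (hs : -Z = Z)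

include hZ

lemma nonempty : Z.Nonempty := hZ.nonempty_interior.mono interior_subset

lemma suppFn_le_iff {x : E} {r : ℝ} : suppFn Z x ≤ r ↔ ∀ z ∈ Z, ⟪x, z⟫ ≤ r := by
  refine ⟨fun h z hz => (inner_le_suppFn hZ.isCompact x hz).trans h, fun h => ?_⟩
  obtain ⟨z, hz, e⟩ := exists_suppFn_eq hZ.isCompact hZ.nonempty x
  exact e ▸ h z hz

lemma polarBody_eq : polarBody Z = {y | suppFn Z y ≤ 1} := by
  ext y
  simp only [polarBody, Set.mem_ofPred_eq, hZ.suppFn_le_iff, real_inner_comm]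

include hs

lemma zero_mem_interior : (0 : E) ∈ interior Z := by
  obtain ⟨z, hz⟩ := hZ.nonempty_interior
  have hz' : -z ∈ interior Z := by
    have h := (Homeomorph.neg E).preimage_interior Z
    change (-interior Z) = interior (-Z) at h
    rw [hs] at h
    rw [← h]; simpa using hz
  have := hZ.convex.interior hz hz' (a := 1 / 2) (b := 1 / 2) (by norm_num) (by norm_num)
    (by norm_num)
  simpa using this

omit [InnerProductSpace ℝ E] hZ in
lemma neg_mem_of_symm {z : E} (hz : z ∈ Z) : -z ∈ Z := by
  rw [← hs]; simpa using hz

lemma isNormFn_suppFn : IsNormFn (suppFn Z) := by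
  have hle : ∀ (r : ℝ) x, suppFn Z (r • x) ≤ |r| * suppFn Z x := by
    intro r x
    rw [hZ.suppFn_le_iff]
    intro z hz
    rw [real_inner_smul_left]
    rcases le_total 0 r with hr | hr
    · rw [abs_of_nonneg hr]
      exact mul_le_mul_of_nonneg_left (inner_le_suppFn hZ.isCompact x hz) hr
    · rw [abs_of_nonpos hr]
      have := mul_le_mul_of_nonneg_left
        (inner_le_suppFn hZ.isCompact x (neg_mem_of_symm hs hz)) (neg_nonneg.2 hr)
      rw [inner_neg_right] at this
      linarith
  have h0 : ∀ x, 0 ≤ suppFn Z x := fun x => by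
    simpa using inner_le_suppFn hZ.isCompact x (interior_subset (hZ.zero_mem_interior hs))
  refine ⟨fun x y => ?_, fun r x => le_antisymm (hle r x) ?_, ?_, ?_⟩
  · rw [hZ.suppFn_le_iff]
    intro z hz
    rw [inner_add_left]
    exact add_le_add (inner_le_suppFn hZ.isCompact x hz) (inner_le_suppFn hZ.isCompact y hz)
  · rcases eq_or_ne r 0 with rfl | hr
    · simpa using h0 0
    · have := hle r⁻¹ (r • x)
      rwa [smul_smul, inv_mul_cancel₀ hr, one_smul, abs_inv,
        le_inv_mul_iff₀ (abs_pos.2 hr)] at this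
  · obtain ⟨ρ, hρ, hb⟩ := Metric.isOpen_iff.1 isOpen_interior 0 (hZ.zero_mem_interior hs)
    refine ⟨ρ / 2, by positivity, fun x => ?_⟩
    rcases eq_or_ne x 0 with rfl | hx
    · simpa using h0 0
    · have hx' := norm_pos_iff.2 hx
      have hm : (ρ / 2 * ‖x‖⁻¹) • x ∈ Z := by
        refine interior_subset (hb ?_)
        rw [mem_ball_zero_iff, norm_smul, Real.norm_of_nonneg (by positivity), mul_assoc,
          inv_mul_cancel₀ hx'.ne']
        linarith
      have := inner_le_suppFn hZ.isCompact x hm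
      rw [real_inner_smul_right, real_inner_self_eq_norm_sq] at this
      refine le_trans (le_of_eq ?_) this
      field_simp
  · obtain ⟨R, hR, hb⟩ := hZ.isCompact.isBounded.exists_pos_norm_le
    refine ⟨R, hR, fun x => ?_⟩
    rw [hZ.suppFn_le_iff]
    intro z hz
    refine (real_inner_le_norm x z).trans ?_
    rw [mul_comm]
    gcongr
    exact hb z hz

omit hs in
-- A point outside Z is strictly separated from it, violating the constraint at the separating
-- normal.
lemma dualBall_suppFn [FiniteDimensional ℝ E] : dualBall (suppFn Z) = Z := by
  refine Set.Subset.antisymm (fun z hz => ?_) fun z hz x => inner_le_suppFn hZ.isCompact x hz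
  by_contra hzZ
  obtain ⟨f, r, h1, h2⟩ := geometric_hahn_banach_closed_point hZ.convex hZ.isCompact.isClosed hzZ
  have hf : ∀ v, ⟪(InnerProductSpace.toDual ℝ E).symm f, v⟫ = f v := fun v => by simp
  have h3 := hz ((InnerProductSpace.toDual ℝ E).symm f)
  rw [hf] at h3
  have h4 : suppFn Z ((InnerProductSpace.toDual ℝ E).symm f) ≤ r :=
    hZ.suppFn_le_iff.2 fun a ha => by rw [hf]; exact (h1 a ha).le
  linarith

omit hs in
lemma polarBody_polarBody [FiniteDimensional ℝ E] (hs : -Z = Z) : polarBody (polarBody Z) = Z := by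
  have hN := hZ.isNormFn_suppFn hs
  rw [hZ.polarBody_eq]
  refine Eq.trans ?_ hZ.dualBall_suppFn
  ext z
  refine ⟨fun h x => ?_, fun h x hx => (h x).trans hx⟩
  by_cases hx : suppFn Z x = 0
  · rw [hN.eq_zero hx]; simp [hN.map_zero]
  · have hpos : 0 < suppFn Z x := lt_of_le_of_ne (hN.nonneg x) (Ne.symm hx)
    have := h ((suppFn Z x)⁻¹ • x) (by
      simp [hN.smul, abs_of_pos hpos, hx])
    rwa [real_inner_smul_left, inv_mul_le_iff₀ hpos, mul_one] at this

lemma neg_polarBody : -polarBody Z = polarBody Z := by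
  have hN := hZ.isNormFn_suppFn hs
  rw [hZ.polarBody_eq]
  ext y
  simp [hN.map_neg]

lemma isConvexBody_polarBody [FiniteDimensional ℝ E] : IsConvexBody (polarBody Z) := by
  have hN := hZ.isNormFn_suppFn hs
  rw [hZ.polarBody_eq]
  obtain ⟨c, hc, hlow⟩ := hN.exists_lower
  obtain ⟨C, hC, hup⟩ := hN.exists_upper
  refine ⟨fun x hx y hy a b ha hb hab => ?_, ?_, ⟨0, ?_⟩⟩
  · have hx : suppFn Z x ≤ 1 := hx
    have hy : suppFn Z y ≤ 1 := hy
    refine (hN.add_le _ _).trans ?_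
    rw [hN.smul_of_nonneg ha, hN.smul_of_nonneg hb]
    nlinarith
  · refine (isCompact_closedBall (0 : E) c⁻¹).of_isClosed_subset
      (isClosed_le hN.continuous continuous_const) fun x hx => ?_
    rw [mem_closedBall_zero_iff, ← one_div, le_div_iff₀ hc, mul_comm]
    exact (hlow x).trans hx
  · rw [mem_interior]
    refine ⟨{x | suppFn Z x < 1}, Set.ofPred_subset_ofPred.2 fun x hx => hx.le,
      isOpen_lt hN.continuous continuous_const, by simp [hN.map_zero]⟩

variable [FiniteDimensional ℝ E] [MeasurableSpace E] [BorelSpace E]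

/-- For a symmetric body the polar with respect to the origin has minimal volume. -/
lemma stdVol_polarBody_le {z : E} (hz : z ∈ Z) :
    stdVol E (polarBody Z) ≤ stdVol E (polarBodyAt Z z) := by
  have hN := hZ.isNormFn_suppFn hs
  have hm := hN.measurable
  set n := Module.finrank ℝ E
  have h1 : stdVol E (polarBodyAt Z z) = stdVol E {y | suppFn Z y - ⟪z, y⟫ ≤ 1} := by
    rw [polarBodyAt, Set.image_add_right, measure_preimage_add_right]
    congr 1
    ext y
    have : suppFn Z y - ⟪z, y⟫ ≤ 1 ↔ suppFn Z y ≤ 1 + ⟪z, y⟫ := sub_le_iff_le_add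
    simp only [Set.mem_ofPred_eq, polarBody, Set.forall_mem_image, this, hZ.suppFn_le_iff,
      inner_sub_left]
    refine forall₂_congr fun x _ => ?_
    rw [sub_le_iff_le_add, real_inner_comm]
  rw [h1, hZ.polarBody_eq]
  have h2 := lintegral_exp_neg_of_homogeneous (M := fun y => suppFn Z y - ⟪z, y⟫)
    (by fun_prop)
    (fun y => by
      have := inner_le_suppFn hZ.isCompact y hz
      rw [real_inner_comm] at this
      linarith)
    (fun r hr y => by rw [hN.smul_of_nonneg hr.le, real_inner_smul_right]; ring)
  -- Average the right integrand over y and -y: since the support function is even, the factor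
  -- cosh⟪z, y⟫ ≥ 1 appears.
  have h3 : expInt (suppFn Z) ≤
      ∫⁻ y, ENNReal.ofReal (Real.exp (-(suppFn Z y - ⟪z, y⟫))) ∂stdVol E := by
    rw [← ENNReal.mul_le_mul_iff_right two_ne_zero (by simp), two_mul
      (∫⁻ y, ENNReal.ofReal (Real.exp (-(suppFn Z y - ⟪z, y⟫))) ∂stdVol E)]
    nth_rw 2 [← (Measure.measurePreserving_neg (stdVol E)).lintegral_comp_emb
      (MeasurableEquiv.neg E).measurableEmbedding]
    rw [← lintegral_add_left (by fun_prop), expInt, ← lintegral_const_mul' _ _ (by simp)]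
    refine lintegral_mono fun y => ?_
    have e2 : (2 : ℝ≥0∞) = ENNReal.ofReal 2 := by simp
    rw [e2, ← ENNReal.ofReal_mul zero_le_two, ← ENNReal.ofReal_add (Real.exp_pos _).le
      (Real.exp_pos _).le]
    refine ENNReal.ofReal_le_ofReal ?_
    simp only [hN.map_neg, inner_neg_right]
    have ea : Real.exp (-(suppFn Z y - ⟪z, y⟫)) = Real.exp (-suppFn Z y) * Real.exp ⟪z, y⟫ := by
      rw [← Real.exp_add]; ring_nf
    have eb : Real.exp (-(suppFn Z y - -⟪z, y⟫)) =
        Real.exp (-suppFn Z y) * Real.exp (-⟪z, y⟫) := by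
      rw [← Real.exp_add]; ring_nf
    rw [ea, eb]
    have := Real.one_le_cosh ⟪z, y⟫
    rw [Real.cosh_eq] at this
    nlinarith [Real.exp_pos (-suppFn Z y)]
  rw [h2, hN.expInt_eq] at h3
  exact (ENNReal.mul_le_mul_iff_right (by exact_mod_cast (Nat.factorial_pos _).ne')
    (ENNReal.natCast_ne_top _)).1 h3

lemma volumeProduct_eq : volumeProduct Z = stdVol E Z * stdVol E (polarBody Z) := by
  have : ⨅ z ∈ interior Z, stdVol E (polarBodyAt Z z) = stdVol E (polarBody Z) := by
    refine le_antisymm ((iInf₂_le 0 (hZ.zero_mem_interior hs)).trans (le_of_eq ?_))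
      (le_iInf₂ fun z hz => hZ.stdVol_polarBody_le hs (interior_subset hz))
    simp [polarBodyAt]
  rw [← this]
  rfl

lemma volumeProduct_polarBody_eq :
    volumeProduct (polarBody Z) = stdVol E Z * stdVol E (polarBody Z) := by
  rw [(hZ.isConvexBody_polarBody hs).volumeProduct_eq (hZ.neg_polarBody hs),
    hZ.polarBody_polarBody hs, mul_comm]

omit [MeasurableSpace E] [BorelSpace E] in
-- The nontrivial inclusion is the lift of `exists_add_smul_mem_dualBall`.
lemma projectionOnto_eq {u : E} (hu : ‖u‖ = 1) :
    projectionOnto (ℝ ∙ u)ᗮ Z = dualBall fun y : (ℝ ∙ u)ᗮ => suppFn Z y := by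
  have hN := hZ.isNormFn_suppFn hs
  ext z
  constructor
  · rintro ⟨x, hx, rfl⟩ y
    rw [Submodule.inner_orthogonalProjectionOnto_eq_of_mem_left]
    exact inner_le_suppFn hZ.isCompact _ hx
  · intro hz
    obtain ⟨t, ht⟩ := hN.exists_add_smul_mem_dualBall hu hz
    rw [hZ.dualBall_suppFn] at ht
    refine ⟨_, ht, ?_⟩
    have h0 : (ℝ ∙ u)ᗮ.orthogonalProjectionOnto u = 0 := by
      rw [Submodule.orthogonalProjectionOnto_eq_zero_iff]
      exact Submodule.le_orthogonal_orthogonal _ (Submodule.mem_span_singleton_self u)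
    simp [h0]

end IsConvexBody

end SupportFunction

/-! ### From Hausdorff limits of zonotopes to support functions -/

section Zonotope

variable {E : Type*} [NormedAddCommGroup E] [InnerProductSpace ℝ E]

lemma inner_le_sum_max {m : ℕ} {a b : Fin m → E} {p : E}
    (hp : p ∈ ∑ i, segment ℝ (a i) (b i)) (x : E) :
    ⟪x, p⟫ ≤ ∑ i, max ⟪x, a i⟫ ⟪x, b i⟫ := by
  obtain ⟨g, hg, rfl⟩ := (Set.mem_fintype_sum _ _).1 hp
  rw [inner_sum]
  refine Finset.sum_le_sum fun i _ => ?_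
  obtain ⟨s, t, hs, ht, hst, e⟩ := hg i
  rw [← e, inner_add_right, real_inner_smul_right, real_inner_smul_right]
  have h1 := mul_le_mul_of_nonneg_left (le_max_left ⟪x, a i⟫ ⟪x, b i⟫) hs
  have h2 := mul_le_mul_of_nonneg_left (le_max_right ⟪x, a i⟫ ⟪x, b i⟫) ht
  calc _ ≤ s * max ⟪x, a i⟫ ⟪x, b i⟫ + t * max ⟪x, a i⟫ ⟪x, b i⟫ := add_le_add h1 h2
    _ = _ := by rw [← add_mul, hst, one_mul]

lemma exists_inner_eq_sum_max {m : ℕ} (a b : Fin m → E) (x : E) :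
    ∃ p ∈ ∑ i, segment ℝ (a i) (b i), ⟪x, p⟫ = ∑ i, max ⟪x, a i⟫ ⟪x, b i⟫ := by
  refine ⟨∑ i, if ⟪x, a i⟫ ≤ ⟪x, b i⟫ then b i else a i,
    (Set.mem_fintype_sum _ _).2 ⟨_, fun i => ?_, rfl⟩, ?_⟩
  · split_ifs
    · exact right_mem_segment ℝ _ _
    · exact left_mem_segment ℝ _ _
  · rw [inner_sum]
    refine Finset.sum_congr rfl fun i _ => ?_
    split_ifs with h
    · rw [max_eq_right h]
    · rw [max_eq_left (not_le.1 h).le]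

/-- The support function of a symmetric zonoid is approximated by those of centred zonotopes. -/
lemma IsConvexBody.isZonoidal_suppFn {Z : Set E} (hZ : IsConvexBody Z) (hs : -Z = Z)
    (hz : IsZonoid Z) : IsZonoidal (suppFn Z) := by
  have hN := hZ.isNormFn_suppFn hs
  obtain ⟨c, hc, hlow⟩ := hN.exists_lower
  intro ε hε
  obtain ⟨-, P, hP, hlim⟩ := hz
  -- The lower bound c‖x‖ ≤ N(x) turns this Hausdorff distance into relative error ε.
  have hδ : 0 < ε * c := by positivity
  obtain ⟨k, hk⟩ := (hlim.eventually_lt_const (ENNReal.ofReal_pos.2 hδ)).exists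
  obtain ⟨m, a, b, hPk⟩ := hP k
  set h : E → ℝ := fun x => ∑ i, max ⟪x, a i⟫ ⟪x, b i⟫
  have hdist : ∀ {p q x : E}, edist p q < ENNReal.ofReal (ε * c) →
      ⟪x, p⟫ ≤ ⟪x, q⟫ + ε * suppFn Z x := by
    intro p q x hpq
    rw [edist_dist, ENNReal.ofReal_lt_ofReal_iff hδ, dist_eq_norm] at hpq
    have h1 : ⟪x, p⟫ = ⟪x, q⟫ + ⟪x, p - q⟫ := by rw [inner_sub_right]; ring
    have h2 : ‖x‖ * ‖p - q‖ ≤ ‖x‖ * (ε * c) := by gcongr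
    have h3 := mul_le_mul_of_nonneg_left (hlow x) hε.le
    linarith [real_inner_le_norm x (p - q)]
  have hup : ∀ x, suppFn Z x ≤ h x + ε * suppFn Z x := by
    intro x
    obtain ⟨z, hz, e⟩ := exists_suppFn_eq hZ.isCompact hZ.nonempty x
    rw [Metric.hausdorffEDist_comm] at hk
    obtain ⟨p, hp, hzp⟩ := Metric.exists_edist_lt_of_hausdorffEDist_lt hz hk
    rw [hPk] at hp
    have := inner_le_sum_max hp x
    have := hdist (x := x) hzp
    rw [← e] at this
    linarith
  have hdown : ∀ x, h x ≤ suppFn Z x + ε * suppFn Z x := by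
    intro x
    obtain ⟨p, hp, e⟩ := exists_inner_eq_sum_max a b x
    rw [← hPk] at hp
    obtain ⟨z, hz, hpz⟩ := Metric.exists_edist_lt_of_hausdorffEDist_lt hp hk
    have := hdist (x := x) hpz
    have := inner_le_suppFn hZ.isCompact x hz
    linarith
  refine ⟨m, fun i => (1 / 2 : ℝ) • (b i - a i), fun x => ?_⟩
  -- Averaging over x and -x centres the segments, as max(p, q) + max(-p, -q) = |p - q|; evenness of
  -- N preserves the error bound.
  have key : ∑ i, |⟪x, (1 / 2 : ℝ) • (b i - a i)⟫| = (h x + h (-x)) / 2 := by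
    simp only [h]
    rw [← Finset.sum_add_distrib, Finset.sum_div]
    refine Finset.sum_congr rfl fun i _ => ?_
    rw [real_inner_smul_right, inner_sub_right, inner_neg_left, inner_neg_left, abs_mul,
      max_neg_neg, ← sub_eq_add_neg, max_sub_min_eq_abs]
    norm_num
    ring
  have h1 := hup x
  have h2 := hup (-x)
  have h3 := hdown x
  have h4 := hdown (-x)
  rw [hN.map_neg] at h2 h4
  rw [key, abs_le]
  constructor <;> linarith

end Zonotope

/-! ### The cube, the cross-polytope and their linear images -/

section Cube

variable {n : ℕ}

lemma volume_unitCube : volume (unitCube n) = 2 ^ n := by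
  have h : unitCube n = WithLp.ofLp ⁻¹' (Set.Icc (fun _ => -1) (fun _ => 1) : Set (Fin n → ℝ)) := by
    ext x
    simp [unitCube, Pi.le_def, abs_le, forall_and]
  rw [h, (PiLp.volume_preserving_ofLp (Fin n)).measure_preimage measurableSet_Icc.nullMeasurableSet,
    Real.volume_Icc_pi]
  norm_num

lemma volume_crossPolytope (hn : 1 ≤ n) :
    volume {x : EuclideanSpace ℝ (Fin n) | ∑ i, |x i| ≤ 1} = 2 ^ n / (n ! : ℝ≥0∞) := by
  have : Nonempty (Fin n) := ⟨⟨0, hn⟩⟩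
  have h : {x : EuclideanSpace ℝ (Fin n) | ∑ i, |x i| ≤ 1} = WithLp.ofLp ⁻¹'
      {x : Fin n → ℝ | (∑ i, |x i| ^ (1 : ℝ)) ^ (1 / (1 : ℝ)) ≤ 1} := by
    ext x; simp
  have hm : MeasurableSet {x : Fin n → ℝ | (∑ i, |x i| ^ (1 : ℝ)) ^ (1 / (1 : ℝ)) ≤ 1} := by
    simp only [Real.rpow_one, div_one]
    exact measurableSet_le (by fun_prop) measurable_const
  rw [h, (PiLp.volume_preserving_ofLp (Fin n)).measure_preimage hm.nullMeasurableSet,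
    volume_sum_rpow_le _ le_rfl]
  have h2 : Real.Gamma (1 / 1 + 1) = 1 := by norm_num
  rw [h2, Fintype.card_fin, div_one, Real.Gamma_nat_eq_factorial,
    ENNReal.ofReal_div_of_pos (by positivity)]
  simp

lemma det_adjoint (T : EuclideanSpace ℝ (Fin n) →ₗ[ℝ] EuclideanSpace ℝ (Fin n)) :
    LinearMap.det (LinearMap.adjoint T) = LinearMap.det T := by
  have b := EuclideanSpace.basisFun (Fin n) ℝ
  rw [← LinearMap.det_toMatrix b.toBasis, ← LinearMap.det_toMatrix b.toBasis,
    LinearMap.toMatrix_adjoint, Matrix.det_conjTranspose]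
  simp

/-- The polar of a linear image of the cube is a linear image of the cross-polytope. -/
lemma polarBody_image_unitCube
    (T : EuclideanSpace ℝ (Fin n) →ₗ[ℝ] EuclideanSpace ℝ (Fin n)) :
    polarBody (T '' unitCube n) =
      LinearMap.adjoint T ⁻¹' {x : EuclideanSpace ℝ (Fin n) | ∑ i, |x i| ≤ 1} := by
  ext y
  simp only [polarBody, Set.forall_mem_image, Set.mem_ofPred_eq, Set.mem_preimage]
  simp_rw [← LinearMap.adjoint_inner_right]
  set w := LinearMap.adjoint T y
  have hin : ∀ c : EuclideanSpace ℝ (Fin n), ⟪c, w⟫ = ∑ i, c i * w i := fun c => by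
    simp [PiLp.inner_apply, mul_comm]
  constructor
  · intro h
    -- The sign vector of w lies in the cube and pairs with w to its ℓ¹ norm.
    have := h (x := WithLp.toLp 2 fun i => (SignType.sign (w i) : ℝ)) (fun i => by
      simp only
      rcases lt_trichotomy (w i) 0 with h | h | h <;> simp [h])
    rw [hin] at this
    simpa [sign_mul_self] using this
  · intro h c hc
    rw [hin]
    refine (Finset.sum_le_sum fun i _ => ?_).trans h
    refine (le_abs_self _).trans ?_
    rw [abs_mul]
    exact mul_le_of_le_one_left (abs_nonneg _) (hc i)

lemma IsLinearCube.volume_mul_volume_polarBody (hn : 1 ≤ n) {Z : Set (EuclideanSpace ℝ (Fin n))}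
    (h : IsLinearCube Z) : volume Z * volume (polarBody Z) = 4 ^ n / (n ! : ℝ≥0∞) := by
  obtain ⟨T, rfl⟩ := h
  have hdet : LinearMap.det (T : EuclideanSpace ℝ (Fin n) →ₗ[ℝ] EuclideanSpace ℝ (Fin n)) ≠ 0 :=
    T.isUnit_det'.ne_zero
  have h1 := Measure.addHaar_image_linearMap volume
    (T : EuclideanSpace ℝ (Fin n) →ₗ[ℝ] EuclideanSpace ℝ (Fin n)) (unitCube n)
  have h2 := polarBody_image_unitCube
    (T : EuclideanSpace ℝ (Fin n) →ₗ[ℝ] EuclideanSpace ℝ (Fin n))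
  simp only [LinearEquiv.coe_coe] at h1 h2
  rw [h1, h2, Measure.addHaar_preimage_linearMap _ (by rwa [det_adjoint]), det_adjoint,
    volume_unitCube, volume_crossPolytope hn]
  set d := LinearMap.det (T : EuclideanSpace ℝ (Fin n) →ₗ[ℝ] EuclideanSpace ℝ (Fin n))
  have hd : ENNReal.ofReal |d| * ENNReal.ofReal |d⁻¹| = 1 := by
    rw [← ENNReal.ofReal_mul (abs_nonneg _), ← abs_mul, mul_inv_cancel₀ hdet]; simp
  calc _ = (ENNReal.ofReal |d| * ENNReal.ofReal |d⁻¹|) * (2 ^ n * (2 ^ n / (n ! : ℝ≥0∞))) := by ring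
    _ = _ := by rw [hd, one_mul, ← mul_div_assoc, ← mul_pow]; norm_num

/-- A vector orthogonal to all b i has N = 0, so the n vectors b i span and form a basis; the dual
ball is the cube in its coordinates. -/
lemma isLinearCube_dualBall {N : EuclideanSpace ℝ (Fin n) → ℝ} (hN : IsNormFn N)
    {b : Fin n → EuclideanSpace ℝ (Fin n)} (hb : ∀ x, N x = ∑ i, |⟪x, b i⟫|) :
    IsLinearCube (dualBall N) := by
  let L : EuclideanSpace ℝ (Fin n) →ₗ[ℝ] EuclideanSpace ℝ (Fin n) :=
    (Fintype.linearCombination ℝ b) ∘ₗ (WithLp.linearEquiv 2 ℝ (Fin n → ℝ)).toLinearMap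
  have hL : ∀ c, L c = ∑ i, c i • b i := fun c => by
    simp [L, Fintype.linearCombination_apply]
  have hLe : ∀ j, L (EuclideanSpace.single j 1) = b j := fun j => by
    rw [hL]; simp
  have hsurj : Function.Surjective L := by
    rw [← LinearMap.range_eq_top, ← Submodule.orthogonal_eq_bot_iff, eq_bot_iff]
    intro x hx
    refine hN.eq_zero ?_
    rw [hb]
    refine Finset.sum_eq_zero fun i _ => ?_
    rw [← hLe, real_inner_comm, hx _ (LinearMap.mem_range_self L _), abs_zero]
  let T := LinearEquiv.ofBijective L ⟨LinearMap.injective_iff_surjective.2 hsurj, hsurj⟩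
  have hT : ∀ c, T c = L c := fun c => rfl
  refine ⟨T, Set.Subset.antisymm (fun z hz => ⟨T.symm z, fun i => ?_, by simp⟩) ?_⟩
  · let f : EuclideanSpace ℝ (Fin n) →L[ℝ] ℝ := LinearMap.toContinuousLinearMap
      ((EuclideanSpace.projₗ i : EuclideanSpace ℝ (Fin n) →ₗ[ℝ] ℝ) ∘ₗ T.symm.toLinearMap)
    set x := (InnerProductSpace.toDual ℝ (EuclideanSpace ℝ (Fin n))).symm f
    have hx : ∀ v, ⟪x, v⟫ = (T.symm v) i := fun v => by simp [x, f]
    have hNx : N x = 1 := by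
      have : ∀ j, T.symm (b j) = EuclideanSpace.single j 1 := fun j => by
        rw [LinearEquiv.symm_apply_eq, hT, hLe]
      rw [hb]
      simp_rw [hx, this]
      simp [apply_ite]
    have h1 := hz x
    have h2 := hz (-x)
    rw [hN.map_neg, inner_neg_left] at h2
    rw [hx] at h1 h2
    rw [hNx] at h1 h2
    exact abs_le.2 ⟨by linarith, h1⟩
  · rintro _ ⟨c, hc, rfl⟩ x
    rw [hT, hL, hb, inner_sum]
    refine Finset.sum_le_sum fun i _ => ?_
    rw [real_inner_smul_right]
    refine (le_abs_self _).trans ?_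
    rw [abs_mul]
    exact mul_le_of_le_one_left (abs_nonneg _) (hc i)

end Cube

/-! ### Translation back to volumes -/

section Main

variable {n : ℕ} {Z : Set (EuclideanSpace ℝ (Fin n))}

/-- The exponential integrals carry the factors n! on E and (n-1)! on the hyperplane; their ratio is
the n in 4/n. -/
lemma exists_projection_section_le (hn : 1 ≤ n) (hbody : IsConvexBody Z) (hZ : IsZonoid Z)
    (hsymm : -Z = Z) :
    ∃ u : EuclideanSpace ℝ (Fin n), ‖u‖ = 1 ∧
      (4 / (n : ℝ≥0∞)) * subspaceVolume (ℝ ∙ u)ᗮ (projectionOnto (ℝ ∙ u)ᗮ Z) *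
          subspaceVolume (ℝ ∙ u)ᗮ (sectionBy (ℝ ∙ u)ᗮ (polarBody Z)) ≤
        volume Z * volume (polarBody Z) := by
  have hN := hbody.isNormFn_suppFn hsymm
  obtain ⟨m, rfl⟩ : ∃ m, n = m + 1 := ⟨n - 1, by omega⟩
  have hfr : Module.finrank ℝ (EuclideanSpace ℝ (Fin (m + 1))) = m + 1 := by simp
  obtain ⟨u, hu, h, -⟩ := hN.exists_four_mul_le (hbody.isZonoidal_suppFn hsymm hZ) (by omega)
  have : Fact (Module.finrank ℝ (EuclideanSpace ℝ (Fin (m + 1))) = m + 1) := ⟨hfr⟩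
  have hF : Module.finrank ℝ (ℝ ∙ u)ᗮ = m :=
    Submodule.finrank_orthogonal_span_singleton (by rintro rfl; simp at hu)
  refine ⟨u, hu, ?_⟩
  rw [IsNormFn.expSlice_zero, (hN.restrict _).expInt_eq, hN.expInt_eq, hbody.dualBall_suppFn, hF,
    hfr, stdVol_eq_volume, ← hbody.polarBody_eq, projVol, ← hbody.projectionOnto_eq hsymm hu] at h
  have hsec : sectionBy (ℝ ∙ u)ᗮ (polarBody Z) = {y : (ℝ ∙ u)ᗮ | suppFn Z y ≤ 1} := by
    rw [hbody.polarBody_eq]; rfl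
  rw [← hsec] at h
  change 4 * (subspaceVolume (ℝ ∙ u)ᗮ _ * (_ * subspaceVolume (ℝ ∙ u)ᗮ _)) ≤ _ at h
  set p := subspaceVolume (ℝ ∙ u)ᗮ (projectionOnto (ℝ ∙ u)ᗮ Z)
  set s := subspaceVolume (ℝ ∙ u)ᗮ (sectionBy (ℝ ∙ u)ᗮ (polarBody Z))
  have hm0 : ((m ! : ℕ) : ℝ≥0∞) ≠ 0 := by exact_mod_cast (Nat.factorial_pos m).ne'
  have hn0 : ((m + 1 : ℕ) : ℝ≥0∞) ≠ 0 := by exact_mod_cast m.succ_ne_zero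
  have e : 4 / ((m + 1 : ℕ) : ℝ≥0∞) * p * s = (4 * p * s) / ((m + 1 : ℕ) : ℝ≥0∞) := by
    simp only [div_eq_mul_inv]; ring
  rw [e]
  refine ENNReal.div_le_of_le_mul ?_
  rw [← ENNReal.mul_le_mul_iff_right hm0 (ENNReal.natCast_ne_top _)]
  calc (m ! : ℝ≥0∞) * (4 * p * s) = 4 * (p * ((m ! : ℝ≥0∞) * s)) := by ring
    _ ≤ _ := h
    _ = _ := by rw [Nat.factorial_succ]; push_cast; ring

/-- Reisner's theorem for the product of the volumes of a zonoid and its polar. -/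
lemma volume_mul_volume_polarBody (hn : 1 ≤ n) (hbody : IsConvexBody Z) (hZ : IsZonoid Z)
    (hsymm : -Z = Z) :
    4 ^ n / (n ! : ℝ≥0∞) ≤ volume Z * volume (polarBody Z) ∧
    (volume Z * volume (polarBody Z) = 4 ^ n / (n ! : ℝ≥0∞) ↔ IsLinearCube Z) := by
  have hN := hbody.isNormFn_suppFn hsymm
  have h := four_pow_le_of_isZonoidal n (E := EuclideanSpace ℝ (Fin n)) (by simp) hN
    (hbody.isZonoidal_suppFn hsymm hZ)
  rw [hN.expInt_eq, hbody.dualBall_suppFn, ← hbody.polarBody_eq, stdVol_eq_volume] at h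
  have hfr : Module.finrank ℝ (EuclideanSpace ℝ (Fin n)) = n := by simp
  have e : volume Z * ((n ! : ℝ≥0∞) * volume (polarBody Z))
      = volume Z * volume (polarBody Z) * (n ! : ℝ≥0∞) := by ring
  rw [hfr, e] at h
  have hn0 : ((n ! : ℕ) : ℝ≥0∞) ≠ 0 := by exact_mod_cast (Nat.factorial_pos n).ne'
  refine ⟨ENNReal.div_le_of_le_mul h.1, fun heq => ?_, fun hc =>
    hc.volume_mul_volume_polarBody hn⟩
  obtain ⟨b, hb⟩ := h.2 (by rw [heq, ENNReal.div_mul_cancel hn0 (ENNReal.natCast_ne_top _)])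
  have := isLinearCube_dualBall hN hb
  rwa [hbody.dualBall_suppFn] at this

end Main

end ConvexVol

theorem mainTheorem7 (n : ℕ) (hn : 1 ≤ n) (Z : Set (EuclideanSpace ℝ (Fin n)))
    (hbody : ConvexVol.IsConvexBody Z) (hZ : ConvexVol.IsZonoid Z) (hsymm : -Z = Z) :
    (∃ u : EuclideanSpace ℝ (Fin n), ‖u‖ = 1 ∧
      (4 / (n : ℝ≥0∞)) *
          ConvexVol.subspaceVolume (ℝ ∙ u)ᗮ (ConvexVol.projectionOnto (ℝ ∙ u)ᗮ Z) *
          ConvexVol.subspaceVolume (ℝ ∙ u)ᗮ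
            (ConvexVol.sectionBy (ℝ ∙ u)ᗮ (ConvexVol.polarBody Z)) ≤
        volume Z * volume (ConvexVol.polarBody Z)) ∧
    (4 : ℝ≥0∞) ^ n / (n ! : ℝ≥0∞) ≤ ConvexVol.volumeProduct Z ∧
    (ConvexVol.volumeProduct Z = (4 : ℝ≥0∞) ^ n / (n ! : ℝ≥0∞) ↔ ConvexVol.IsLinearCube Z) ∧
    (4 : ℝ≥0∞) ^ n / (n ! : ℝ≥0∞) ≤ ConvexVol.volumeProduct (ConvexVol.polarBody Z) ∧
    (ConvexVol.volumeProduct (ConvexVol.polarBody Z) = (4 : ℝ≥0∞) ^ n / (n ! : ℝ≥0∞) ↔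
      ConvexVol.IsLinearCube Z) := by
  obtain ⟨h1, h2⟩ := ConvexVol.volume_mul_volume_polarBody hn hbody hZ hsymm
  rw [hbody.volumeProduct_polarBody_eq hsymm, hbody.volumeProduct_eq hsymm,
    ConvexVol.stdVol_eq_volume]
  exact ⟨ConvexVol.exists_projection_section_le hn hbody hZ hsymm, h1, h2, h1, h2⟩
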